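/- Let $p$ be a prime, let $\mathcal O$ be the ring of integers of a finite extension of $\mathbb Q_p$ with uniformizer $\varpi$, let $\Gamma$ be a topological group isomorphic to $\mathbb Z_p$ with a fixed topological generator $\gamma$, and let $\Lambda=\mathcal O[[\Gamma]]=\varprojlim_n \mathcal O[\Gamma/\Gamma^{p^n}]$ be the Iwasawa algebra. A polynomial $F\in\mathcal O[X]$ is regarded as an element of $\Lambda$ through $X=\gamma-1$; it is called distinguished if it is monic and all its other coefficients lie in $\varpi\mathcal O$. For every finitely generated $\Lambda$-module $M$ there is a pseudo-isomorphism (a $\Lambda$-linear map with finite kernel and finite cokernel) \[ M\longrightarrow \Lambda^{\oplus r}\oplus\bigoplus_{i=1}^s\Lambda/(\varpi^{a_i})\oplus\bigoplus_{j=1}^t\Lambda/(F_j) \] with integers $r,s,t\ge 0$, $a_i\ge 1$ and distinguished polynomials $F_j$, and the integers $\mu(M)=\sum_i a_i$ and $\lambda(M)=\sum_j\deg F_j$ do not depend on the choice of it. Let \[ 0\to A\to B\to C\to 0 \] be a short exact sequence of finitely generated $\Lambda$-modules in which $A$ is a torsion module. Then $\lambda$ and $\mu$ (which are well defined for $A$,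 $B$ and $C$ in the above sense) satisfy \[ \lambda(A)+\lambda(C)=\lambda(B)\qquad\text{and}\qquad \mu(A)+\mu(C)=\mu(B). \] -/

import Mathlib

noncomputable section

namespace Iwasawa

universe u v w

section Algebra

variable (p : ℕ) (Γ : Type v) [CommGroup Γ]

/-- The subgroup `Γ_n = Γ^{p^n}` of `p^n`-th powers in the commutative group `Γ`. -/
def layer (n : ℕ) : Subgroup Γ := (powMonoidHom (p ^ n) : Γ →* Γ).range

theorem layer_antitone {m n : ℕ} (h : m ≤ n) : layer p Γ n ≤ layer p Γ m := by
  rintro _ ⟨x, rfl⟩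
  refine ⟨x ^ p ^ (n - m), ?_⟩
  simp only [powMonoidHom_apply]
  rw [← pow_mul, ← pow_add, Nat.sub_add_cancel h]

/-- The canonical projection `Γ/Γ_n → Γ/Γ_m` for `m ≤ n`. -/
def layerMap {m n : ℕ} (h : m ≤ n) : Γ ⧸ layer p Γ n →* Γ ⧸ layer p Γ m :=
  QuotientGroup.map (layer p Γ n) (layer p Γ m) (MonoidHom.id Γ) (layer_antitone p Γ h)

variable (O : Type u) [CommRing O]

/-- The completed group algebra `O[[Γ]] = lim_n O[Γ/Γ_n]`: the compatible families in
`∏_n O[Γ/Γ_n]`, as an `O`-subalgebra of the product. -/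
def completedGroupAlgebra : Subalgebra O (∀ n : ℕ, MonoidAlgebra O (Γ ⧸ layer p Γ n)) where
  carrier := {x | ∀ (m n : ℕ) (h : m ≤ n),
    MonoidAlgebra.mapDomainAlgHom O O (layerMap p Γ h) (x n) = x m}
  mul_mem' := by
    intro x y hx hy m n h
    rw [Pi.mul_apply, Pi.mul_apply, map_mul, hx m n h, hy m n h]
  add_mem' := by
    intro x y hx hy m n h
    rw [Pi.add_apply, Pi.add_apply, map_add, hx m n h, hy m n h]
  algebraMap_mem' := by
    intro r m n h
    rw [Pi.algebraMap_apply, Pi.algebraMap_apply, AlgHom.commutes]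

/-- The Iwasawa algebra `Λ = O[[Γ]]`. -/
def IwasawaAlgebra : Type (max u v) := completedGroupAlgebra p Γ O

instance : CommRing (IwasawaAlgebra p Γ O) :=
  inferInstanceAs (CommRing (completedGroupAlgebra p Γ O))

instance : Algebra O (IwasawaAlgebra p Γ O) :=
  inferInstanceAs (Algebra O (completedGroupAlgebra p Γ O))

variable {Γ}

/-- The group-like element `[γ] ∈ O[[Γ]]` attached to `γ ∈ Γ`. -/
def groupLike (γ : Γ) : IwasawaAlgebra p Γ O :=
  ⟨fun n => MonoidAlgebra.single (QuotientGroup.mk γ : Γ ⧸ layer p Γ n) 1, by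
    intro m n h
    rw [MonoidAlgebra.mapDomainAlgHom_apply, MonoidAlgebra.mapDomain_single]
    rfl⟩

variable {O}

/-- The element `F([γ] - 1)` of `Λ` given by a polynomial `F ∈ O[X]`, with `X = [γ] - 1`. -/
def ofPolynomial (γ : Γ) (F : Polynomial O) : IwasawaAlgebra p Γ O :=
  Polynomial.aeval (groupLike p O γ - 1) F

end Algebra

/-- A pseudo-isomorphism: a linear map with finite kernel and finite cokernel. -/
def IsPseudoIso {R : Type*} [Ring R] {M N : Type*} [AddCommGroup M] [Module R M]
    [AddCommGroup N] [Module R N] (f : M →ₗ[R] N) : Prop :=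
  Finite (LinearMap.ker f) ∧ Finite (N ⧸ LinearMap.range f)

section Invariants

variable (p : ℕ) {Γ : Type v} [CommGroup Γ] {O : Type u} [CommRing O] [IsLocalRing O]
  (γ : Γ) (ϖ : O)

/-- The module `Λ^r ⊕ ⨁_i Λ/ϖ^{a_i} ⊕ ⨁_j Λ/(F_j)`. -/
abbrev ElementaryModule {r s t : ℕ} (a : Fin s → ℕ) (F : Fin t → Polynomial O) :
    Type (max u v) :=
  (Fin r → IwasawaAlgebra p Γ O) ×
  (∀ i : Fin s, IwasawaAlgebra p Γ O ⧸
    Ideal.span {algebraMap O (IwasawaAlgebra p Γ O) ϖ ^ a i}) ×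
  (∀ j : Fin t, IwasawaAlgebra p Γ O ⧸ Ideal.span {ofPolynomial p γ (F j)})

/-- The data of a pseudo-isomorphism `M → Λ^r ⊕ ⨁_i Λ/ϖ^{a_i} ⊕ ⨁_j Λ/(F_j)` with all
`a_i ≥ 1` and all `F_j` distinguished polynomials. -/
structure Decomposition (M : Type w) [AddCommGroup M] [Module (IwasawaAlgebra p Γ O) M] where
  r : ℕ
  s : ℕ
  t : ℕ
  a : Fin s → ℕ
  one_le_a : ∀ i, 1 ≤ a i
  F : Fin t → Polynomial O
  distinguished : ∀ j, (F j).IsDistinguishedAt (IsLocalRing.maximalIdeal O)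
  toElementary : M →ₗ[IwasawaAlgebra p Γ O] ElementaryModule p γ ϖ (r := r) a F
  isPseudoIso : IsPseudoIso toElementary

/-- The sum `∑ a_i` of the exponents of `ϖ` in a decomposition. -/
def Decomposition.mu {p : ℕ} {γ : Γ} {ϖ : O} {M : Type w} [AddCommGroup M]
    [Module (IwasawaAlgebra p Γ O) M] (d : Decomposition p γ ϖ M) : ℕ := ∑ i, d.a i

/-- The sum `∑ deg F_j` of the degrees of the polynomials in a decomposition. -/
def Decomposition.lambda {p : ℕ} {γ : Γ} {ϖ : O} {M : Type w} [AddCommGroup M]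
    [Module (IwasawaAlgebra p Γ O) M] (d : Decomposition p γ ϖ M) : ℕ := ∑ j, (d.F j).natDegree

variable (M : Type w) [AddCommGroup M] [Module (IwasawaAlgebra p Γ O) M]

open Classical in
/-- The `μ`-invariant `∑ a_i` of `M`, read off from a decomposition of `M` up to
pseudo-isomorphism (and `0` by convention when there is none). -/
def muInvariant : ℕ :=
  if h : Nonempty (Decomposition p γ ϖ M) then h.some.mu else 0

open Classical in
/-- The `λ`-invariant `∑ deg F_j` of `M`, read off from a decomposition of `M` up to
pseudo-isomorphism (and `0` by convention when there is none). -/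
def lambdaInvariant : ℕ :=
  if h : Nonempty (Decomposition p γ ϖ M) then h.some.lambda else 0

/-- The invariants `μ(M)` and `λ(M)` are genuinely defined: `M` has a decomposition up to
pseudo-isomorphism, and every such decomposition computes the same two numbers. -/
def InvariantsWellDefined : Prop :=
  Nonempty (Decomposition p γ ϖ M) ∧
    ∀ d : Decomposition p γ ϖ M,
      d.mu = muInvariant p γ ϖ M ∧ d.lambda = lambdaInvariant p γ ϖ M

end Invariants

end Iwasawa

end

/-! Both invariants are lengths of localizations of the torsion submodule: `λ(M)` is the dimension
of `torsion M` over the fraction field of `O`, and `μ(M)` is the length of `torsion M` localized at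
the prime `(ϖ)` of `Λ` (`Decomposition.lambda_eq`, `Decomposition.mu_eq`). Localizing at a prime
with infinite residue ring kills finite modules, so a pseudo-isomorphism changes neither length; on
the elementary module they are `∑ deg F_j` and `∑ a_i`. Hence every decomposition gives the same
numbers.

Additivity then follows from the exactness of localization and the additivity of length, once `0 →
torsion A → torsion B → torsion C → 0` is exact. Only surjectivity is at stake: a lift of a torsion
element is torsion because `A` is (`localLength_torsion_add`).

Existence of a decomposition rests on `Λ ≅ O⟦X⟧` with `X = γ - 1`, which brings in Weierstrass
preparation and division. They make `Λ[1/ϖ]` and `Λ` localized at `(ϖ)` principal ideal domains. The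
structure theorem over each, with denominators cleared, gives the maps to the `Λ/(F_j)` and the
`Λ/(ϖ^{a_i})`; a saturation argument supplies the free part. Kernel and cokernel of the combined map
are killed elementwise both by powers of `ϖ` and by elements prime to `ϖ`, hence are finite
(`exists_isPseudoIso`). -/

namespace Iwasawa

open IsLocalRing

/-! ### Adic completeness of `O`. -/

section Completeness

variable (p : ℕ) [Fact p.Prime] (O : Type*) [CommRing O] [IsDomain O] [CharZero O]
  [Algebra ℤ_[p] O]

theorem faithfulSMul_padicInt : FaithfulSMul ℤ_[p] O := by
  rw [faithfulSMul_iff_algebraMap_injective, injective_iff_map_eq_zero]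
  intro x hx
  by_contra hne
  obtain ⟨n, u, rfl⟩ := IsDiscreteValuationRing.eq_unit_mul_pow_irreducible hne
    (PadicInt.irreducible_p (p := p))
  have hu : IsUnit (algebraMap ℤ_[p] O u) := u.isUnit.map _
  rw [map_mul, map_pow, map_natCast, hu.mul_right_eq_zero] at hx
  have hp : (p : O) ≠ 0 := Nat.cast_ne_zero.mpr (Fact.out : p.Prime).ne_zero
  exact pow_ne_zero n hp hx

variable [IsDiscreteValuationRing O] [Module.Finite ℤ_[p] O]

theorem natCast_mem_maximalIdeal :  (p : O) ∈ maximalIdeal O := by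
  have := faithfulSMul_padicInt p O
  have : IsLocalHom (algebraMap ℤ_[p] O) := inferInstance
  rw [mem_maximalIdeal, mem_nonunits_iff]
  intro h
  rw [← map_natCast (algebraMap ℤ_[p] O)] at h
  exact PadicInt.irreducible_p.not_isUnit (isUnit_of_map_unit _ _ h)

theorem exists_maximalIdeal_pow_eq_span : ∃ e : ℕ, 0 < e ∧
    maximalIdeal O ^ e = Ideal.span {(p : O)} := by
  obtain ⟨ϖ, hϖ⟩ := IsDiscreteValuationRing.exists_irreducible O
  have hp : (p : O) ≠ 0 := Nat.cast_ne_zero.mpr (Fact.out : p.Prime).ne_zero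
  obtain ⟨e, he⟩ := IsDiscreteValuationRing.ideal_eq_span_pow_irreducible
    (s := Ideal.span {(p : O)}) (by simpa using hp) hϖ
  refine ⟨e, Nat.pos_of_ne_zero ?_, ?_⟩
  · rintro rfl
    rw [pow_zero, Ideal.span_singleton_one, Ideal.span_singleton_eq_top] at he
    exact (mem_maximalIdeal _).mp (natCast_mem_maximalIdeal p O) he
  · rw [hϖ.maximalIdeal_eq, Ideal.span_singleton_pow, he]

theorem isAdicComplete_maximalIdeal (p : ℕ) [Fact p.Prime] (O : Type*) [CommRing O] [IsDomain O]
    [CharZero O] [Algebra ℤ_[p] O] [IsDiscreteValuationRing O] [Module.Finite ℤ_[p] O] :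
    IsAdicComplete (maximalIdeal O) O := by
  have := faithfulSMul_padicInt p O
  have : Module.IsTorsionFree ℤ_[p] O := inferInstance
  have hHaus : IsHausdorff (maximalIdeal O) O :=
    IsHausdorff.of_le_jacobson (maximalIdeal O) O
      (by rw [IsLocalRing.jacobson_eq_maximalIdeal ⊥ bot_ne_top])
  refine { toIsHausdorff := hHaus, prec' := fun f hf => ?_ }
  obtain ⟨e, he0, he⟩ := exists_maximalIdeal_pow_eq_span p O
  let b := Module.Free.chooseBasis ℤ_[p] O
  simp only [smul_eq_mul, Ideal.mul_top, SModEq.sub_mem] at hf ⊢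
  -- Only the indices `e * n` are used: modulo `𝔪^(e * n) = (p^n)` a congruence in `O` is a
  -- congruence modulo `p^n` of each coordinate in a `ℤ_p`-basis, so the limit can be taken in
  -- `ℤ_p`.
  have hspan (n : ℕ) : maximalIdeal O ^ (e * n) = Ideal.span {(p : O) ^ n} := by
    rw [pow_mul, he, Ideal.span_singleton_pow]
  have hcoord (i) {m n : ℕ} (hmn : m ≤ n) :
      b.repr (f (e * m)) i ≡ b.repr (f (e * n)) i
        [SMOD (maximalIdeal ℤ_[p] ^ m • ⊤ : Submodule ℤ_[p] ℤ_[p])] := by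
    have h := hf (Nat.mul_le_mul_left e hmn)
    rw [hspan, Ideal.mem_span_singleton'] at h
    obtain ⟨c, hc⟩ := h
    have hc' : f (e * m) - f (e * n) = (p : ℤ_[p]) ^ m • c := by
      rw [← hc, Algebra.smul_def, map_pow, map_natCast, mul_comm]
    simp only [smul_eq_mul, Ideal.mul_top, SModEq.sub_mem]
    rw [← Finsupp.sub_apply, ← map_sub, hc', map_smul, Finsupp.smul_apply, smul_eq_mul]
    refine Ideal.mul_mem_right _ _ (Ideal.pow_mem_pow ?_ m)
    rw [PadicInt.maximalIdeal_eq_span_p]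
    exact Ideal.mem_span_singleton_self _
  choose L hL using fun i => IsPrecomplete.prec' (I := maximalIdeal ℤ_[p])
    (fun n => b.repr (f (e * n)) i) (fun h => hcoord i h)
  refine ⟨b.equivFun.symm L, fun n => ?_⟩
  have hpn : (p : O) ^ n ∈ maximalIdeal O ^ n :=
    Ideal.pow_mem_pow (natCast_mem_maximalIdeal p O) n
  have h1 : f n - f (e * n) ∈ maximalIdeal O ^ n := hf (Nat.le_mul_of_pos_left n he0)
  have h2 : f (e * n) - b.equivFun.symm L ∈ maximalIdeal O ^ n := by
    have hc : ∀ i, ∃ c : ℤ_[p], b.repr (f (e * n)) i - L i = c * (p : ℤ_[p]) ^ n := by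
      intro i
      have h := hL i n
      simp only [smul_eq_mul, Ideal.mul_top, SModEq.sub_mem] at h
      rw [PadicInt.maximalIdeal_eq_span_p, Ideal.span_singleton_pow,
        Ideal.mem_span_singleton'] at h
      obtain ⟨c, hc⟩ := h
      exact ⟨c, hc.symm⟩
    choose c hc using hc
    have : f (e * n) - b.equivFun.symm L = (p : O) ^ n * b.equivFun.symm c := by
      apply b.equivFun.injective
      have : (p : O) ^ n * b.equivFun.symm c = (p : ℤ_[p]) ^ n • b.equivFun.symm c := by
        rw [Algebra.smul_def, map_pow, map_natCast]
      rw [this]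
      ext i
      simp only [map_sub, map_smul, LinearEquiv.apply_symm_apply, Pi.sub_apply, Pi.smul_apply,
        smul_eq_mul, Module.Basis.equivFun_apply, hc]
      ring
    rw [this]
    exact Ideal.mul_mem_right _ _ hpn
  simpa using add_mem h1 h2

end Completeness

/-- The consequences of Weierstrass preparation and division for an algebra `Λ` over a discrete
valuation ring `O` that behaves like the power series ring `O⟦T⟧`. -/
structure IsWeierstrassAlgebra {O Λ : Type*} [CommRing O] [IsLocalRing O] [CommRing Λ]
    [Algebra O Λ] (ϖ : O) (T : Λ) : Prop where
  prime : Prime (algebraMap O Λ ϖ)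
  not_dvd : ¬ algebraMap O Λ ϖ ∣ T
  exists_eq_mul : ∀ g : Λ, g ≠ 0 → ∃ (n : ℕ) (u : Λˣ) (F : Polynomial O),
    F.IsDistinguishedAt (maximalIdeal O) ∧ g = algebraMap O Λ ϖ ^ n * (u * Polynomial.aeval T F)
  exists_division : ∀ F : Polynomial O, F.IsDistinguishedAt (maximalIdeal O) → ∀ g : Λ,
    ∃ (q : Λ) (r : Polynomial O), r.degree < F.degree ∧
      g = Polynomial.aeval T F * q + Polynomial.aeval T r
  eq_zero_of_dvd : ∀ F : Polynomial O, F.IsDistinguishedAt (maximalIdeal O) → ∀ r : Polynomial O,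
    r.degree < F.degree → Polynomial.aeval T F ∣ Polynomial.aeval T r → r = 0
  quotientEquiv : ∀ F : Polynomial O, F.IsDistinguishedAt (maximalIdeal O) →
    Nonempty ((Fin F.natDegree → O) ≃ₗ[O] Λ ⧸ Ideal.span {Polynomial.aeval T F})

/-! ### Weierstrass theory in `O⟦X⟧`. -/

section PowerSeries

variable {O : Type*} [CommRing O]

open PowerSeries in
theorem powerSeries_dvd_iff (f : PowerSeries O) (a : O) :
    algebraMap O (PowerSeries O) a ∣ f ↔ ∀ i, a ∣ coeff i f := by
  constructor
  · rintro ⟨g, rfl⟩ i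
    rw [← Algebra.smul_def, coeff_smul]
    exact dvd_mul_right _ _
  · intro h
    choose c hc using h
    refine ⟨PowerSeries.mk c, ?_⟩
    ext i
    rw [← Algebra.smul_def, coeff_smul, coeff_mk, hc, smul_eq_mul]

theorem aeval_X_powerSeries (F : Polynomial O) :
    Polynomial.aeval (PowerSeries.X : PowerSeries O) F = (F : PowerSeries O) := by
  have : Polynomial.aeval (PowerSeries.X : PowerSeries O) =
      Polynomial.coeToPowerSeries.algHom (R := O) O := by
    ext
    simp
  rw [this]
  simp

variable [IsDomain O] [IsDiscreteValuationRing O] {ϖ : O}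

/-- Primality of `ϖ` in `O⟦X⟧` comes from this: reduction lands in power series over the residue
field, a domain. -/
theorem map_residue_eq_zero_iff (hϖ : Irreducible ϖ) (f : PowerSeries O) :
    f.map (residue O) = 0 ↔ algebraMap O (PowerSeries O) ϖ ∣ f := by
  rw [powerSeries_dvd_iff, PowerSeries.ext_iff]
  refine forall_congr' fun i => ?_
  rw [PowerSeries.coeff_map, map_zero, residue_eq_zero_iff, hϖ.maximalIdeal_eq,
    Ideal.mem_span_singleton]

theorem powerSeries_prime (hϖ : Irreducible ϖ) : Prime (algebraMap O (PowerSeries O) ϖ) := by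
  refine ⟨?_, ?_, ?_⟩
  · intro h
    have := congrArg PowerSeries.constantCoeff h
    exact hϖ.ne_zero (by simpa using this)
  · intro h
    rw [PowerSeries.isUnit_iff_constantCoeff] at h
    exact hϖ.not_isUnit (by simpa using h)
  · intro a b h
    simpa only [← map_residue_eq_zero_iff hϖ, map_mul, mul_eq_zero] using h

/-- Weierstrass division bounds remainders by the order of the reduced divisor; this turns the bound
into one by the degree. -/
theorem degree_eq_order_map_of_isDistinguishedAt {F : Polynomial O}
    (hF : F.IsDistinguishedAt (maximalIdeal O)) : F.degree =
      ((F : PowerSeries O).map (Ideal.Quotient.mk (maximalIdeal O))).order.toNat := by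
  have h1 := hF.coe_natDegree_eq_order_map (F : PowerSeries O) 1 (by simp) (by simp)
  rw [← h1, Polynomial.degree_eq_natDegree hF.monic.ne_zero]
  rfl

theorem powerSeries_isWeierstrassAlgebra [IsAdicComplete (maximalIdeal O) O]
    (hϖ : Irreducible ϖ) : IsWeierstrassAlgebra ϖ (PowerSeries.X : PowerSeries O) where
  prime := powerSeries_prime hϖ
  not_dvd h := by
    rw [powerSeries_dvd_iff] at h
    have := h 1
    rw [PowerSeries.coeff_one_X] at this
    exact hϖ.not_isUnit (isUnit_of_dvd_one this)
  exists_eq_mul g hg := by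
    obtain ⟨n, c, hc, rfl⟩ := WfDvdMonoid.max_power_factor hg (powerSeries_prime hϖ).irreducible
    rw [← map_residue_eq_zero_iff hϖ] at hc
    obtain ⟨F, h, H⟩ := PowerSeries.exists_isWeierstrassFactorization hc
    obtain ⟨u, rfl⟩ := H.isUnit
    exact ⟨n, u, F, H.isDistinguishedAt, by rw [aeval_X_powerSeries, H.eq_mul, mul_comm (F : PowerSeries O)]⟩
  exists_division F hF g := by
    have H := hF.isWeierstrassDivisorAt'.isWeierstrassDivisionAt_div_mod g
    exact ⟨_, _, H.degree_lt.trans_eq (degree_eq_order_map_of_isDistinguishedAt hF).symm, by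
      simpa only [aeval_X_powerSeries] using H.eq_mul_add⟩
  eq_zero_of_dvd F hF r hr hdvd := by
    obtain ⟨c, hc⟩ := hdvd
    rw [aeval_X_powerSeries, aeval_X_powerSeries] at hc
    rw [degree_eq_order_map_of_isDistinguishedAt hF] at hr
    -- The series `r` has two divisions by `F`: quotient `0` with remainder `r`, and quotient `c`
    -- with remainder `0`. Uniqueness gives `r = 0`.
    refine (hF.isWeierstrassDivisorAt'.eq_of_mul_add_eq_mul_add (q := 0) (q' := c) (r' := 0)
      hr ?_ ?_).2
    · rw [Polynomial.degree_zero]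
      exact WithBot.bot_lt_coe _
    · rw [hc, mul_zero, zero_add, Polynomial.coe_zero, add_zero]
  quotientEquiv F hF := by
    rw [aeval_X_powerSeries]
    exact ⟨(AdjoinRoot.powerBasisAux' hF.monic).equivFun.symm.trans
      hF.algEquivQuotient.toLinearEquiv⟩

end PowerSeries

end Iwasawa

namespace Iwasawa

open IsLocalRing

/-! ### Separation and completeness of `O⟦X⟧` for a chain of principal ideals. -/

section Approximation

variable {O : Type*} [CommRing O] (I : Ideal O)

open PowerSeries

/-- The filtration of `O⟦X⟧` by the powers of the ideal generated by `I` and `X`, described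
coefficientwise. -/
def MemFiltration (n : ℕ) (f : PowerSeries O) : Prop := ∀ i, coeff i f ∈ I ^ (n - i)

variable {I}

theorem MemFiltration.add {n : ℕ} {f g : PowerSeries O} (hf : MemFiltration I n f)
    (hg : MemFiltration I n g) : MemFiltration I n (f + g) := fun i => by
  rw [map_add]
  exact add_mem (hf i) (hg i)

theorem MemFiltration.mono {m n : ℕ} (h : m ≤ n) {f : PowerSeries O} (hf : MemFiltration I n f) :
    MemFiltration I m f := fun i => Ideal.pow_le_pow_right (by omega) (hf i)

theorem memFiltration_zero (f : PowerSeries O) : MemFiltration I 0 f := fun i => by simp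

theorem MemFiltration.mul {a b : ℕ} {f g : PowerSeries O} (hf : MemFiltration I a f)
    (hg : MemFiltration I b g) : MemFiltration I (a + b) (f * g) := fun i => by
  rw [coeff_mul]
  refine sum_mem fun x hx => ?_
  have hx := Finset.HasAntidiagonal.mem_antidiagonal.mp hx
  have hab : a + b - i ≤ (a - x.1) + (b - x.2) := by omega
  refine Ideal.pow_le_pow_right hab ?_
  rw [pow_add]
  exact Ideal.mul_mem_mul (hf _) (hg _)

theorem memFiltration_one_iff {f : PowerSeries O} :
    MemFiltration I 1 f ↔ constantCoeff f ∈ I := by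
  constructor
  · intro h
    simpa using h 0
  · intro h i
    obtain rfl | hi := Nat.eq_zero_or_pos i
    · simpa using h
    · rw [Nat.sub_eq_zero_of_le hi, pow_zero, Ideal.one_eq_top]
      trivial

theorem eq_zero_of_forall_memFiltration [IsHausdorff I O] {f : PowerSeries O}
    (hf : ∀ n, MemFiltration I n f) : f = 0 := by
  ext i
  rw [map_zero]
  refine IsHausdorff.haus' (I := I) _ fun n => ?_
  rw [SModEq.zero, smul_eq_mul, Ideal.mul_top]
  simpa using hf (n + i) i

theorem exists_memFiltration_sub [IsPrecomplete I O] {f : ℕ → PowerSeries O}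
    (hf : ∀ n, MemFiltration I n (f (n + 1) - f n)) :
    ∃ L, ∀ n, MemFiltration I n (L - f n) := by
  have hf' (m k : ℕ) : MemFiltration I m (f (m + k) - f m) := by
    induction k with
    | zero => intro i; simp
    | succ k ih =>
      have := ih.add ((hf (m + k)).mono (Nat.le_add_right m k))
      rwa [show f (m + k) - f m + (f (m + k + 1) - f (m + k)) = f (m + (k + 1)) - f m by
        rw [← add_assoc]; ring] at this
  -- The shift by `i` compensates for the filtration, whose step `n` controls the coefficient of
  -- index `i` only modulo `I^(n - i)`.
  choose L hL using fun i => IsPrecomplete.prec' (I := I) (fun k => coeff i (f (k + i)))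
    (fun {m n} h => by
      obtain ⟨k, rfl⟩ := Nat.exists_eq_add_of_le h
      have := hf' (m + i) k i
      rw [Nat.add_sub_cancel, add_right_comm, map_sub] at this
      refine SModEq.symm ?_
      rwa [SModEq.sub_mem, smul_eq_mul, Ideal.mul_top])
  refine ⟨PowerSeries.mk L, fun n i => ?_⟩
  obtain h | h := le_total n i
  · rw [Nat.sub_eq_zero_of_le h, pow_zero, Ideal.one_eq_top]
    trivial
  · have := (hL i (n - i)).symm
    rw [SModEq.sub_mem, smul_eq_mul, Ideal.mul_top, Nat.sub_add_cancel h] at this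
    rwa [map_sub, coeff_mk]

variable {w u : ℕ → PowerSeries O}

theorem eq_zero_of_forall_dvd [IsHausdorff I O] (h0 : MemFiltration I 1 (w 0))
    (hu : ∀ n, MemFiltration I 1 (u n)) (hw : ∀ n, w (n + 1) = w n * u n) {f : PowerSeries O}
    (hf : ∀ n, w n ∣ f) : f = 0 := by
  have h (n : ℕ) : MemFiltration I (n + 1) (w n) := by
    induction n with
    | zero => exact h0
    | succ n ih => rw [hw]; exact ih.mul (hu n)
  refine eq_zero_of_forall_memFiltration (I := I) fun n => ?_
  obtain ⟨c, rfl⟩ := hf n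
  exact ((h n).mul (memFiltration_zero c)).mono (by omega)

/-- A limit `L` exists by completeness. That `w n` divides `L - f n` exactly needs the quotients to
converge as well; separatedness then identifies `L - f n` with `w n` times their limit. -/
theorem exists_forall_dvd_sub [IsAdicComplete I O] (h0 : MemFiltration I 1 (w 0))
    (hu : ∀ n, MemFiltration I 1 (u n)) (hw : ∀ n, w (n + 1) = w n * u n)
    {f : ℕ → PowerSeries O} (hf : ∀ n, w n ∣ f (n + 1) - f n) :
    ∃ L, ∀ n, w n ∣ L - f n := by
  have h (n : ℕ) : MemFiltration I (n + 1) (w n) := by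
    induction n with
    | zero => exact h0
    | succ n ih => rw [hw]; exact ih.mul (hu n)
  choose c hc using hf
  obtain ⟨L, hL⟩ := exists_memFiltration_sub (I := I) (f := f) fun n => by
    rw [hc]
    exact ((h n).mul (memFiltration_zero _)).mono (by omega)
  refine ⟨L, fun n => ?_⟩
  -- `V j` is the cofactor `w (n + j) / w n`, and `q j` below is the quotient of `f (n + j) - f n`
  -- by `w n`.
  let V : ℕ → PowerSeries O := fun j => ∏ i ∈ Finset.range j, u (n + i)
  have hV (j : ℕ) : MemFiltration I j (V j) := by
    induction j with
    | zero => exact memFiltration_zero _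
    | succ j ih =>
      simp only [V, Finset.prod_range_succ] at ih ⊢
      exact ih.mul (hu _)
  have hwV (j : ℕ) : w (n + j) = w n * V j := by
    induction j with
    | zero => simp [V]
    | succ j ih => rw [← add_assoc, hw, ih]; simp only [V, Finset.prod_range_succ]; ring
  let q : ℕ → PowerSeries O := fun j => ∑ i ∈ Finset.range j, V i * c (n + i)
  have hq (j : ℕ) : f (n + j) - f n = w n * q j := by
    induction j with
    | zero => simp [q]
    | succ j ih =>
      have h1 := hc (n + j)
      rw [hwV] at h1
      simp only [q, Finset.sum_range_succ] at ih ⊢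
      rw [mul_add, ← ih, ← mul_assoc, ← h1, ← add_assoc]
      ring
  obtain ⟨Q, hQ⟩ := exists_memFiltration_sub (I := I) (f := q) fun j => by
    simp only [q, Finset.sum_range_succ, add_sub_cancel_left]
    exact (hV j).mul (memFiltration_zero _)
  refine ⟨Q, sub_eq_zero.mp (eq_zero_of_forall_memFiltration (I := I) fun j => ?_)⟩
  have h1 := (hL (n + j)).mono (Nat.le_add_left j n)
  have h2 := (memFiltration_zero (I := I) (-w n)).mul (hQ j)
  rw [zero_add] at h2
  convert h1.add h2 using 1
  have := hq j
  linear_combination this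

end Approximation

/-! ### The polynomials `(X + 1)^(p^n) - 1` and group algebras of finite cyclic groups. -/

section Cyclotomic

variable (p : ℕ) (O : Type*) [CommRing O]

open Polynomial

/-- The polynomial `(X + 1)^{p^n} - 1`. -/
noncomputable def layerPolynomial (n : ℕ) : O[X] := (X + 1) ^ p ^ n - 1

theorem layerPolynomial_succ (n : ℕ) : layerPolynomial p O (n + 1) =
    layerPolynomial p O n * ∑ i ∈ Finset.range p, ((X + 1) ^ p ^ n) ^ i := by
  rw [layerPolynomial, layerPolynomial, mul_geom_sum, ← pow_mul, ← pow_succ]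

variable [Fact p.Prime] [Nontrivial O]

theorem natDegree_X_add_one_pow (n : ℕ) : ((X + 1 : O[X]) ^ n).natDegree = n := by
  rw [← C_1, natDegree_pow_X_add_C]

theorem one_degree_lt (n : ℕ) : (1 : O[X]).degree < ((X + 1 : O[X]) ^ p ^ n).degree := by
  rw [degree_one, degree_eq_natDegree, natDegree_X_add_one_pow]
  · exact_mod_cast pow_pos (Fact.out : p.Prime).pos n
  · exact ((monic_X_add_C (1 : O)).pow _).ne_zero

theorem monic_layerPolynomial (n : ℕ) : (layerPolynomial p O n).Monic :=
  Monic.sub_of_left ((monic_X_add_C (1 : O)).pow _) (one_degree_lt p O n)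

theorem natDegree_layerPolynomial (n : ℕ) : (layerPolynomial p O n).natDegree = p ^ n := by
  rw [layerPolynomial, natDegree_sub_eq_left_of_natDegree_lt, natDegree_X_add_one_pow]
  rw [natDegree_X_add_one_pow, natDegree_one]
  exact pow_pos (Fact.out : p.Prime).pos n

theorem isDistinguishedAt_layerPolynomial {I : Ideal O} (hI : (p : O) ∈ I) (n : ℕ) :
    (layerPolynomial p O n).IsDistinguishedAt I where
  monic := monic_layerPolynomial p O n
  mem {i} hi := by
    rw [natDegree_layerPolynomial] at hi
    rw [layerPolynomial, coeff_sub, coeff_X_add_one_pow, coeff_one]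
    obtain rfl | h0 := eq_or_ne i 0
    · simp
    · rw [if_neg h0, sub_zero]
      obtain ⟨c, hc⟩ := (Fact.out : p.Prime).dvd_choose_pow h0 hi.ne
      rw [hc, Nat.cast_mul]
      exact Ideal.mul_mem_right _ _ hI

end Cyclotomic

section GroupAlgebra

variable {O : Type*} [CommRing O] {G : Type*} [CommGroup G] {g : G}

open Polynomial

/-- The powers of `g` below its order are distinct group elements, hence linearly independent over
`O`. -/
theorem aeval_single_eq_zero {s : O[X]} (hs : s.natDegree < orderOf g)
    (h : aeval (MonoidAlgebra.single g (1 : O)) s = 0) : s = 0 := by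
  rw [aeval_eq_sum_range] at h
  ext i
  rw [coeff_zero]
  by_cases hi : s.natDegree < i
  · exact coeff_eq_zero_of_natDegree_lt hi
  · have h1 := congrArg (fun y => y.coeff (g ^ i)) h
    simp only [MonoidAlgebra.single_pow, one_pow, MonoidAlgebra.smul_single, smul_eq_mul, mul_one,
      MonoidAlgebra.coeff_sum, Finsupp.finsetSum_apply, MonoidAlgebra.coeff_single] at h1
    rw [Finset.sum_eq_single i] at h1
    · simpa using h1
    · intro j hj hji
      refine Finsupp.single_eq_of_ne' fun hgj => ?_
      rw [Finset.mem_range] at hj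
      exact hji (pow_injOn_Iio_orderOf (Set.mem_Iio.mpr (by omega)) (Set.mem_Iio.mpr (by omega)) hgj)
    · intro h
      simp only [Finset.mem_range] at h
      omega

theorem aeval_single_sub_one_surjective (hg : ∀ x : G, ∃ n : ℕ, g ^ n = x) :
    Function.Surjective (aeval (R := O) (MonoidAlgebra.single g (1 : O) - 1)) := by
  intro y
  induction y using MonoidAlgebra.induction_linear with
  | zero => exact ⟨0, map_zero _⟩
  | add a b ha hb =>
    obtain ⟨a, rfl⟩ := ha
    obtain ⟨b, rfl⟩ := hb
    exact ⟨a + b, map_add _ _ _⟩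
  | single x r =>
    obtain ⟨n, rfl⟩ := hg x
    refine ⟨C r * (X + 1) ^ n, ?_⟩
    simp [MonoidAlgebra.single_pow]

/-- The remainder modulo the monic `layerPolynomial` has degree below the order of `g`, so it
vanishes as soon as its value does. -/
theorem aeval_single_sub_one_eq_zero_iff [Nontrivial O] {p : ℕ} [Fact p.Prime] {n : ℕ} (hg : orderOf g = p ^ n)
    (F : O[X]) : aeval (MonoidAlgebra.single g (1 : O) - 1) F = 0 ↔
      layerPolynomial p O n ∣ F := by
  have h0 : aeval (MonoidAlgebra.single g (1 : O) - 1) (layerPolynomial p O n) = 0 := by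
    simp [layerPolynomial, MonoidAlgebra.single_pow, ← hg, pow_orderOf_eq_one,
      MonoidAlgebra.one_def]
  constructor
  · intro hF
    have hm := monic_layerPolynomial p O n
    rw [← modByMonic_eq_zero_iff_dvd hm]
    set r := F %ₘ layerPolynomial p O n with hr
    have hr0 : aeval (MonoidAlgebra.single g (1 : O) - 1) r = 0 := by
      rw [hr, modByMonic_eq_sub_mul_div _ _, map_sub, map_mul, h0, zero_mul, hF, sub_zero]
    have hdeg : r.natDegree < p ^ n := by
      rw [← natDegree_layerPolynomial p O n]
      refine natDegree_modByMonic_lt F hm ?_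
      intro h1
      have := natDegree_layerPolynomial p O n
      rw [h1, natDegree_one] at this
      exact absurd this (pow_pos (Fact.out : p.Prime).pos n).ne
    -- The substitution `X ↦ X - 1` turns evaluation at `g - 1` into evaluation at `g`.
    have hs : r.comp (X - C 1) = 0 := by
      apply aeval_single_eq_zero (g := g)
      · rw [hg]
        refine lt_of_le_of_lt natDegree_comp_le ?_
        rwa [natDegree_X_sub_C, mul_one]
      · rw [aeval_comp]
        simpa using hr0
    have : r = (r.comp (X - C 1)).comp (X + C 1) := by
      rw [comp_assoc]
      simp
    rw [this, hs, zero_comp]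
  · rintro ⟨c, rfl⟩
    rw [map_mul, h0, zero_mul]

end GroupAlgebra

end Iwasawa

namespace Iwasawa

open IsLocalRing

/-! ### The finite cyclic quotients of `Γ`. -/

section Layers

variable {p : ℕ} [Fact p.Prime] {Γ : Type*} [CommGroup Γ]

theorem mem_layer_iff (φ : Γ ≃* Multiplicative ℤ_[p]) (n : ℕ) (x : Γ) :
    x ∈ layer p Γ n ↔ PadicInt.toZModPow n (φ x).toAdd = 0 := by
  rw [← RingHom.mem_ker, PadicInt.ker_toZModPow, Ideal.mem_span_singleton]
  constructor
  · rintro ⟨y, rfl⟩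
    refine ⟨(φ y).toAdd, ?_⟩
    simp [nsmul_eq_mul]
  · rintro ⟨c, hc⟩
    refine ⟨φ.symm (Multiplicative.ofAdd c), φ.injective ?_⟩
    rw [powMonoidHom_apply, map_pow, MulEquiv.apply_symm_apply]
    apply Multiplicative.toAdd.injective
    rw [hc]
    simp [nsmul_eq_mul]

theorem card_quotient_layer (φ : Γ ≃* Multiplicative ℤ_[p]) (n : ℕ) :
    Nat.card (Γ ⧸ layer p Γ n) = p ^ n := by
  let ψ : Γ →* Multiplicative (ZMod (p ^ n)) :=
    (AddMonoidHom.toMultiplicative (PadicInt.toZModPow n : ℤ_[p] →+* ZMod (p ^ n)).toAddMonoidHom).comp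
      φ.toMonoidHom
  have hψ : Function.Surjective ψ := by
    intro y
    obtain ⟨z, hz⟩ := ZMod.ringHom_surjective (PadicInt.toZModPow (p := p) n) y.toAdd
    obtain ⟨x, hx⟩ := φ.surjective (Multiplicative.ofAdd z)
    refine ⟨x, ?_⟩
    change Multiplicative.ofAdd (PadicInt.toZModPow n (φ x).toAdd) = y
    rw [hx, toAdd_ofAdd, hz, ofAdd_toAdd]
  have hker : ψ.ker = layer p Γ n := by
    ext x
    rw [mem_layer_iff φ, MonoidHom.mem_ker]
    rfl
  rw [← hker, Nat.card_congr (QuotientGroup.quotientKerEquivOfSurjective ψ hψ).toEquiv]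
  exact Nat.card_zmod _

variable [TopologicalSpace Γ] [IsTopologicalGroup Γ]

/-- The layer is closed, as the compact image of a power map, and of finite index, hence open. The
dense subgroup generated by `γ` therefore meets every coset; finiteness of the quotient allows
natural exponents. -/
theorem exists_pow_eq_mk_layer (φ : Γ ≃ₜ* Multiplicative ℤ_[p]) {γ : Γ}
    (hγ : (Subgroup.zpowers γ).topologicalClosure = ⊤) (n : ℕ) (x : Γ ⧸ layer p Γ n) :
    ∃ k : ℕ, (QuotientGroup.mk γ : Γ ⧸ layer p Γ n) ^ k = x := by
  have hpos : 0 < p ^ n := pow_pos (Fact.out : p.Prime).pos n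
  have hcard := card_quotient_layer φ.toMulEquiv n
  have : Finite (Γ ⧸ layer p Γ n) := Nat.finite_of_card_ne_zero (by omega)
  have hfin : (layer p Γ n).FiniteIndex := Subgroup.finiteIndex_of_finite_quotient
  have : CompactSpace (Multiplicative ℤ_[p]) := inferInstanceAs (CompactSpace ℤ_[p])
  have : CompactSpace Γ := φ.toHomeomorph.symm.compactSpace
  have : T2Space (Multiplicative ℤ_[p]) := inferInstanceAs (T2Space ℤ_[p])
  have : T2Space Γ := φ.toHomeomorph.symm.t2Space
  have hclosed : IsClosed (layer p Γ n : Set Γ) := by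
    have : (layer p Γ n : Set Γ) = Set.range (fun x : Γ => x ^ p ^ n) := rfl
    rw [this]
    exact (isCompact_range (continuous_pow _)).isClosed
  have hopen := Subgroup.isOpen_of_isClosed_of_finiteIndex _ hclosed
  obtain ⟨y, rfl⟩ := QuotientGroup.mk_surjective x
  have hy : y ∈ closure (Subgroup.zpowers γ : Set Γ) := by
    rw [← Subgroup.topologicalClosure_coe, hγ]
    trivial
  rw [mem_closure_iff] at hy
  obtain ⟨z, hz, k, rfl⟩ := hy ((fun z => y⁻¹ * z) ⁻¹' (layer p Γ n))
    (hopen.preimage (continuous_const.mul continuous_id)) (by simp)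
  have hmem : (QuotientGroup.mk y : Γ ⧸ layer p Γ n) ∈
      Subgroup.zpowers (QuotientGroup.mk γ : Γ ⧸ layer p Γ n) := by
    refine ⟨k, ?_⟩
    have := QuotientGroup.eq.mpr hz
    exact this.symm
  rw [← mem_powers_iff_mem_zpowers] at hmem
  exact hmem

theorem orderOf_mk_layer (φ : Γ ≃ₜ* Multiplicative ℤ_[p]) {γ : Γ}
    (hγ : (Subgroup.zpowers γ).topologicalClosure = ⊤) (n : ℕ) :
    orderOf (QuotientGroup.mk γ : Γ ⧸ layer p Γ n) = p ^ n := by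
  rw [← card_quotient_layer φ.toMulEquiv n]
  refine orderOf_eq_card_of_forall_mem_zpowers fun x => ?_
  obtain ⟨k, rfl⟩ := exists_pow_eq_mk_layer φ hγ n x
  exact Subgroup.npow_mem_zpowers _ _

end Layers

/-! ### The isomorphism of `O⟦X⟧` with `O[[Γ]]`. -/

section PowerSeriesEquiv

open Polynomial

variable {p : ℕ} {O : Type*} [CommRing O] {I : Ideal O}

theorem layerPolynomial_dvd {m n : ℕ} (h : m ≤ n) :
    layerPolynomial p O m ∣ layerPolynomial p O n := by
  obtain ⟨k, rfl⟩ := Nat.exists_eq_add_of_le h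
  induction k with
  | zero => exact dvd_rfl
  | succ k ih =>
    rw [← add_assoc, layerPolynomial_succ]
    exact (ih (Nat.le_add_right m k)).mul_right _

/-- The constant terms are `p` for the successive quotients and `0` for the first polynomial, which
is `X`. -/
theorem layerPolynomial_memFiltration (hI : (p : O) ∈ I) :
    (∀ n, MemFiltration I 1 ((∑ i ∈ Finset.range p, ((X + 1 : O[X]) ^ p ^ n) ^ i : O[X]) :
      PowerSeries O)) ∧ MemFiltration I 1 (layerPolynomial p O 0 : PowerSeries O) := by
  constructor
  · intro n
    rw [memFiltration_one_iff, ← PowerSeries.coeff_zero_eq_constantCoeff_apply,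
      Polynomial.coeff_coe, coeff_zero_eq_eval_zero, eval_finsetSum]
    simpa using hI
  · rw [memFiltration_one_iff, ← PowerSeries.coeff_zero_eq_constantCoeff_apply,
      Polynomial.coeff_coe, coeff_zero_eq_eval_zero, layerPolynomial]
    simp

theorem exists_polynomial_dvd_sub [IsAdicComplete I O] {F : O[X]}
    (hF : F.IsDistinguishedAt I) (f : PowerSeries O) :
    ∃ G : O[X], (F : PowerSeries O) ∣ f - G := by
  have h := (hF.isWeierstrassDivisorAt'.isWeierstrassDivisionAt_div_mod f).eq_mul_add
  exact ⟨_, _, sub_eq_iff_eq_add.mpr h⟩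

variable [Fact p.Prime] [Nontrivial O] [IsAdicComplete I O] (hI : (p : O) ∈ I) {G : Type*} [CommGroup G] {g : G} {n : ℕ}
  (hg : orderOf g = p ^ n)

/-- The evaluation `O⟦X⟧ → O[G]`, `X ↦ g - 1`, for an element `g` of order `p^n`. -/
noncomputable def evalGroupAlgebra : PowerSeries O →ₐ[O] MonoidAlgebra O G :=
  ((Ideal.Quotient.liftₐ (Ideal.span {layerPolynomial p O n})
      (aeval (MonoidAlgebra.single g (1 : O) - 1))
      fun F hF => (aeval_single_sub_one_eq_zero_iff hg F).mpr
        (Ideal.mem_span_singleton.mp hF)).comp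
    (isDistinguishedAt_layerPolynomial p O hI n).algEquivQuotient.symm.toAlgHom).comp
    (Ideal.Quotient.mkₐ O (Ideal.span {(layerPolynomial p O n : PowerSeries O)}))

theorem evalGroupAlgebra_coe (F : O[X]) : evalGroupAlgebra hI hg (F : PowerSeries O) =
    aeval (MonoidAlgebra.single g (1 : O) - 1) F := by
  have h : (isDistinguishedAt_layerPolynomial p O hI n).algEquivQuotient.symm
      (Ideal.Quotient.mk _ (F : PowerSeries O)) = Ideal.Quotient.mk _ F := by
    rw [AlgEquiv.symm_apply_eq]
    rfl
  simp only [evalGroupAlgebra, AlgHom.comp_apply]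
  erw [h]
  rfl

theorem evalGroupAlgebra_eq_zero_iff (f : PowerSeries O) : evalGroupAlgebra hI hg f = 0 ↔
    (layerPolynomial p O n : PowerSeries O) ∣ f := by
  obtain ⟨F, hF⟩ := Ideal.Quotient.mk_surjective
    ((isDistinguishedAt_layerPolynomial p O hI n).algEquivQuotient.symm
      (Ideal.Quotient.mk _ f))
  have h : (layerPolynomial p O n : PowerSeries O) ∣ f - F := by
    rw [eq_comm, AlgEquiv.symm_apply_eq] at hF
    rw [← Ideal.mem_span_singleton, ← Ideal.Quotient.mk_eq_mk_iff_sub_mem, hF]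
    rfl
  have h0 (c : PowerSeries O) : evalGroupAlgebra hI hg ((layerPolynomial p O n : PowerSeries O) * c) = 0 := by
    rw [map_mul, evalGroupAlgebra_coe, (aeval_single_sub_one_eq_zero_iff hg _).mpr dvd_rfl, zero_mul]
  constructor
  · intro hf
    obtain ⟨c, hc⟩ := h
    rw [sub_eq_iff_eq_add.mp hc, map_add, h0, zero_add, evalGroupAlgebra_coe,
      aeval_single_sub_one_eq_zero_iff hg] at hf
    obtain ⟨d, rfl⟩ := hf
    rw [sub_eq_iff_eq_add.mp hc, Polynomial.coe_mul]
    exact dvd_add (dvd_mul_right _ _) (dvd_mul_right _ _)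
  · rintro ⟨c, rfl⟩
    exact h0 c

theorem evalGroupAlgebra_surjective (hg' : ∀ x : G, ∃ k : ℕ, g ^ k = x) :
    Function.Surjective (evalGroupAlgebra hI hg) := by
  intro y
  obtain ⟨F, rfl⟩ := aeval_single_sub_one_surjective hg' y
  exact ⟨F, evalGroupAlgebra_coe hI hg F⟩

variable {Γ : Type*} [CommGroup Γ] {γ : Γ}
  (hγ : ∀ n, orderOf (QuotientGroup.mk γ : Γ ⧸ layer p Γ n) = p ^ n)

/-- Both sides depend on `f` only modulo the polynomial of layer `n`, a multiple of that of layer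
`m`, so `f` may be replaced by a polynomial. -/
theorem mapDomain_evalGroupAlgebra {m n : ℕ} (h : m ≤ n) (f : PowerSeries O) :
    MonoidAlgebra.mapDomainAlgHom O O (layerMap p Γ h) (evalGroupAlgebra hI (hγ n) f) =
      evalGroupAlgebra hI (hγ m) f := by
  obtain ⟨F, c, hc⟩ := exists_polynomial_dvd_sub (isDistinguishedAt_layerPolynomial p O hI n) f
  have h1 : evalGroupAlgebra hI (hγ n) f = evalGroupAlgebra hI (hγ n) F := by
    rw [← sub_eq_zero, ← map_sub, evalGroupAlgebra_eq_zero_iff, hc]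
    exact dvd_mul_right _ _
  have h2 : evalGroupAlgebra hI (hγ m) f = evalGroupAlgebra hI (hγ m) F := by
    rw [← sub_eq_zero, ← map_sub, evalGroupAlgebra_eq_zero_iff, hc]
    obtain ⟨d, hd⟩ := layerPolynomial_dvd (p := p) (O := O) h
    rw [hd, Polynomial.coe_mul, mul_assoc]
    exact dvd_mul_right _ _
  rw [h1, h2, evalGroupAlgebra_coe, evalGroupAlgebra_coe, ← aeval_algHom_apply, map_sub, map_one,
    MonoidAlgebra.mapDomainAlgHom_apply, MonoidAlgebra.mapDomain_single]
  rfl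

/-- The map `O⟦X⟧ → O[[Γ]]`, `X ↦ γ - 1`. -/
noncomputable def ofPowerSeries : PowerSeries O →ₐ[O] IwasawaAlgebra p Γ O :=
  (AlgHom.codRestrict (AlgHom.pi fun n => evalGroupAlgebra hI (hγ n))
    (completedGroupAlgebra p Γ O) fun f _ _ h => mapDomain_evalGroupAlgebra hI hγ h f :
      PowerSeries O →ₐ[O] completedGroupAlgebra p Γ O)

theorem ofPowerSeries_val (f : PowerSeries O) (n : ℕ) :
    (ofPowerSeries hI hγ f).1 n = evalGroupAlgebra hI (hγ n) f := rfl

theorem ofPowerSeries_X : ofPowerSeries hI hγ PowerSeries.X = groupLike p O γ - 1 := by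
  apply Subtype.ext
  funext n
  rw [ofPowerSeries_val, ← Polynomial.coe_X, evalGroupAlgebra_coe, aeval_X]
  rfl

/-- The kernel at layer `n` is generated by `layerPolynomial p O n`. Injectivity is separation for
these ideals, and surjectivity is completeness. -/
theorem ofPowerSeries_bijective
    (hγ' : ∀ n, ∀ x : Γ ⧸ layer p Γ n, ∃ k : ℕ, (QuotientGroup.mk γ : Γ ⧸ layer p Γ n) ^ k = x) :
    Function.Bijective (ofPowerSeries hI hγ) := by
  obtain ⟨hu, h0⟩ := layerPolynomial_memFiltration hI
  have hw (n : ℕ) : (layerPolynomial p O (n + 1) : PowerSeries O) = layerPolynomial p O n *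
      ((∑ i ∈ Finset.range p, ((X + 1 : O[X]) ^ p ^ n) ^ i : O[X]) : PowerSeries O) := by
    rw [layerPolynomial_succ, Polynomial.coe_mul]
  let w : ℕ → PowerSeries O := fun n => (layerPolynomial p O n : PowerSeries O)
  constructor
  · rw [injective_iff_map_eq_zero]
    intro f hf
    refine eq_zero_of_forall_dvd (w := w) h0 hu hw fun n => ?_
    rw [← evalGroupAlgebra_eq_zero_iff hI (hγ n), ← ofPowerSeries_val hI hγ, hf]
    rfl
  · intro x
    choose f hf using fun n => evalGroupAlgebra_surjective hI (hγ n) (hγ' n) (x.1 n)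
    obtain ⟨L, hL⟩ := exists_forall_dvd_sub (w := w) h0 hu hw (f := f) fun n => by
      rw [← evalGroupAlgebra_eq_zero_iff hI (hγ n), map_sub, hf,
        ← mapDomain_evalGroupAlgebra hI hγ n.le_succ, hf, sub_eq_zero]
      exact x.2 n (n + 1) n.le_succ
    refine ⟨L, Subtype.ext (funext fun n => ?_)⟩
    rw [ofPowerSeries_val, ← hf, ← sub_eq_zero, ← map_sub, evalGroupAlgebra_eq_zero_iff]
    exact hL n

end PowerSeriesEquiv

section Transport

variable {O Λ Λ' : Type*} [CommRing O] [IsLocalRing O] [CommRing Λ] [CommRing Λ'] [Algebra O Λ]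
  [Algebra O Λ'] {ϖ : O} {T : Λ}

theorem IsWeierstrassAlgebra.of_algEquiv (h : IsWeierstrassAlgebra ϖ T) (e : Λ ≃ₐ[O] Λ') :
    IsWeierstrassAlgebra ϖ (e T) where
  prime := by
    rw [← e.commutes]
    exact (MulEquiv.prime_iff e).mpr h.prime
  not_dvd := by
    rw [← e.commutes, map_dvd_iff]
    exact h.not_dvd
  exists_eq_mul g hg := by
    obtain ⟨n, u, F, hF, hg⟩ := h.exists_eq_mul (e.symm g) (by simpa using hg)
    refine ⟨n, Units.map e u, F, hF, ?_⟩
    rw [← e.apply_symm_apply g, hg]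
    simp [Polynomial.aeval_algHom_apply]
  exists_division F hF g := by
    obtain ⟨q, r, hr, hg⟩ := h.exists_division F hF (e.symm g)
    refine ⟨e q, r, hr, ?_⟩
    rw [← e.apply_symm_apply g, hg]
    simp [Polynomial.aeval_algHom_apply]
  eq_zero_of_dvd F hF r hr hdvd := by
    rw [Polynomial.aeval_algHom_apply, Polynomial.aeval_algHom_apply, map_dvd_iff] at hdvd
    exact h.eq_zero_of_dvd F hF r hr hdvd
  quotientEquiv F hF := by
    obtain ⟨i⟩ := h.quotientEquiv F hF
    refine ⟨i.trans (Ideal.quotientEquivAlg _ _ e ?_).toLinearEquiv⟩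
    rw [Ideal.map_span, Set.image_singleton]
    congr 2
    exact Polynomial.aeval_algHom_apply e T F

end Transport

/-- `O[[Γ]]` is a power series ring over `O` in the variable `γ - 1`. -/
theorem exists_powerSeries_algEquiv (p : ℕ) [Fact p.Prime] (O : Type*) [CommRing O] [IsDomain O]
    [IsDiscreteValuationRing O] [CharZero O] [Algebra ℤ_[p] O] [Module.Finite ℤ_[p] O]
    {Γ : Type*} [CommGroup Γ] [TopologicalSpace Γ] [IsTopologicalGroup Γ]
    (φ : Γ ≃ₜ* Multiplicative ℤ_[p]) {γ : Γ}
    (hγ : (Subgroup.zpowers γ).topologicalClosure = ⊤) :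
    ∃ e : PowerSeries O ≃ₐ[O] IwasawaAlgebra p Γ O, e PowerSeries.X = groupLike p O γ - 1 := by
  have := isAdicComplete_maximalIdeal p O
  exact ⟨AlgEquiv.ofBijective _ (ofPowerSeries_bijective (natCast_mem_maximalIdeal p O)
    (orderOf_mk_layer φ hγ) (exists_pow_eq_mk_layer φ hγ)), ofPowerSeries_X _ _⟩

end Iwasawa

namespace Iwasawa

/-! ### Lengths of localized modules. -/

section LocalLength

variable {A : Type*} [CommRing A] (P : Ideal A)

/-- If the annihilator of `m` were inside `P`, the finite ring modulo it would surject onto the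
infinite `A ⧸ P`. This is why finite modules vanish in the localization. -/
theorem exists_notMem_smul_eq_zero_of_finite [Infinite (A ⧸ P)] {M : Type*} [AddCommGroup M]
    [Module A M] [Finite M] (m : M) :
    ∃ s ∉ P, s • m = 0 := by
  by_contra! h
  have hle : LinearMap.ker (LinearMap.toSpanSingleton A M m) ≤ P := by
    intro s hs
    by_contra hsP
    exact h s hsP (by simpa using hs)
  have : Finite (A ⧸ LinearMap.ker (LinearMap.toSpanSingleton A M m)) :=
    Finite.of_injective _ (LinearMap.quotKerEquivRange _).injective
  have hsurj := Ideal.Quotient.factor_surjective hle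
  exact not_finite_iff_infinite.mpr ‹_› (Finite.of_surjective _ hsurj)

variable [P.IsPrime]

/-- The length of the localization of a module at a prime ideal. -/
noncomputable def localLength (M : Type*) [AddCommGroup M] [Module A M] : ℕ∞ :=
  Module.length (Localization.AtPrime P) (LocalizedModule P.primeCompl M)

variable {M N Q : Type*} [AddCommGroup M] [Module A M] [AddCommGroup N] [Module A N]
  [AddCommGroup Q] [Module A Q]

theorem localLength_eq_add_of_exact (f : M →ₗ[A] N) (g : N →ₗ[A] Q)
    (hf : Function.Injective f) (hg : Function.Surjective g) (hfg : Function.Exact f g) :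
    localLength P N = localLength P M + localLength P Q :=
  Module.length_eq_add_of_exact (LocalizedModule.map P.primeCompl f)
    (LocalizedModule.map P.primeCompl g) (LocalizedModule.map_injective _ _ hf)
    (LocalizedModule.map_surjective _ _ hg) (LocalizedModule.map_exact _ _ _ hfg)

theorem localLength_eq_zero (h : ∀ m : M, ∃ s ∉ P, s • m = 0) : localLength P M = 0 := by
  rw [localLength, Module.length_eq_zero_iff, LocalizedModule.subsingleton_iff]
  exact h

theorem localLength_eq_of_linearMap (f : M →ₗ[A] N)
    (hker : ∀ m : M, f m = 0 → ∃ s ∉ P, s • m = 0)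
    (hcoker : ∀ n : N, ∃ s ∉ P, ∃ m, f m = s • n) :
    localLength P M = localLength P N := by
  rw [localLength_eq_add_of_exact P (LinearMap.ker f).subtype f.rangeRestrict
      (Submodule.subtype_injective _) f.surjective_rangeRestrict (by
        rw [LinearMap.exact_iff, LinearMap.ker_rangeRestrict, Submodule.range_subtype]),
    localLength_eq_add_of_exact P (LinearMap.range f).subtype (LinearMap.range f).mkQ
      (Submodule.subtype_injective _) (Submodule.mkQ_surjective _)
      (LinearMap.exact_subtype_mkQ _),
    localLength_eq_zero P (M := LinearMap.ker f), localLength_eq_zero P (M := N ⧸ LinearMap.range f),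
    zero_add, add_zero]
  · intro x
    obtain ⟨n, rfl⟩ := Submodule.mkQ_surjective _ x
    obtain ⟨s, hs, m, hm⟩ := hcoker n
    refine ⟨s, hs, ?_⟩
    rw [← map_smul, ← hm, Submodule.mkQ_apply, Submodule.Quotient.mk_eq_zero]
    exact ⟨m, rfl⟩
  · rintro ⟨m, hm⟩
    obtain ⟨s, hs, h⟩ := hker m hm
    exact ⟨s, hs, Subtype.ext h⟩

theorem localLength_congr (e : M ≃ₗ[A] N) : localLength P M = localLength P N := by
  have h1 : (1 : A) ∉ P := P.ne_top_iff_one.mp (Ideal.IsPrime.ne_top ‹_›)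
  refine localLength_eq_of_linearMap P e.toLinearMap (fun m hm => ⟨1, h1, ?_⟩)
    fun n => ⟨1, h1, e.symm n, by simp⟩
  rw [one_smul]
  exact e.map_eq_zero_iff.mp hm

theorem localLength_prod : localLength P (M × N) = localLength P M + localLength P N :=
  localLength_eq_add_of_exact P (LinearMap.inl A M N) (LinearMap.snd A M N)
    LinearMap.inl_injective LinearMap.snd_surjective Function.Exact.inl_snd

theorem localLength_pi {n : ℕ} (M : Fin n → Type*) [∀ i, AddCommGroup (M i)]
    [∀ i, Module A (M i)] : localLength P (∀ i, M i) = ∑ i, localLength P (M i) := by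
  induction n with
  | zero =>
    rw [Finset.univ_eq_empty, Finset.sum_empty]
    exact localLength_eq_zero P fun m => ⟨1, P.ne_top_iff_one.mp (Ideal.IsPrime.ne_top ‹_›),
      Subsingleton.elim _ _⟩
  | succ n ih =>
    rw [Fin.sum_univ_succ, ← ih fun i => M i.succ]
    refine localLength_eq_add_of_exact P (LinearMap.single A M 0)
      (LinearMap.pi fun i : Fin n => LinearMap.proj i.succ) (Pi.single_injective 0) ?_ ?_
    · intro y
      exact ⟨Fin.cons 0 y, funext fun i => by simp⟩
    · intro y
      constructor
      · intro hy
        refine ⟨y 0, funext fun i => ?_⟩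
        refine Fin.cases (by simp) (fun j => ?_) i
        have := congrFun hy j
        simpa using this.symm
      · rintro ⟨x, rfl⟩
        funext i
        simp

theorem localLength_quotient_self : localLength P (A ⧸ P) = 1 := by
  rw [localLength, Module.length_eq_one_iff, isSimpleModule_iff_toSpanSingleton_surjective]
  have h1 : (1 : A) ∉ P := P.ne_top_iff_one.mp (Ideal.IsPrime.ne_top ‹_›)
  constructor
  · rw [← not_subsingleton_iff_nontrivial, LocalizedModule.subsingleton_iff]
    intro h
    obtain ⟨s, hs, h⟩ := h (Ideal.Quotient.mk P 1)
    rw [← Ideal.Quotient.mk_eq_mk, ← Submodule.Quotient.mk_smul, smul_eq_mul, mul_one,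
      Submodule.Quotient.mk_eq_zero] at h
    exact hs h
  · intro x hx y
    induction x using LocalizedModule.induction_on with
    | _ a s =>
    induction y using LocalizedModule.induction_on with
    | _ b t =>
    obtain ⟨a, rfl⟩ := Ideal.Quotient.mk_surjective a
    obtain ⟨b, rfl⟩ := Ideal.Quotient.mk_surjective b
    have ha : a ∉ P := by
      intro ha
      apply hx
      rw [Ideal.Quotient.eq_zero_iff_mem.mpr ha, LocalizedModule.zero_mk]
    -- The scalar solves `z • (a / s) = b / t`, the numerator `a` being invertible since it lies
    -- outside `P`.
    refine ⟨Localization.mk (b * s) (t * ⟨a, ha⟩), ?_⟩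
    rw [LinearMap.toSpanSingleton_apply, LocalizedModule.mk_smul_mk, LocalizedModule.mk_eq]
    refine ⟨1, ?_⟩
    simp only [Submonoid.smul_def, one_smul, Submonoid.coe_mul]
    simp only [← Ideal.Quotient.mk_eq_mk, ← Submodule.Quotient.mk_smul, smul_eq_mul]
    congr 1
    ring

end LocalLength

end Iwasawa

namespace Iwasawa

open IsLocalRing Polynomial

/-! ### Prime ideals and finite modules of a Weierstrass algebra. -/

section WeierstrassAlgebra

variable {O Λ : Type*} [CommRing O] [IsDomain O] [IsDiscreteValuationRing O]
  [CommRing Λ] [Algebra O Λ] {ϖ : O} {T : Λ}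

theorem exists_aeval_eq_pow_add (hϖ : Irreducible ϖ) {F : O[X]}
    (hF : F.IsDistinguishedAt (maximalIdeal O)) (T : Λ) :
    ∃ c, aeval T F = T ^ F.natDegree + algebraMap O Λ ϖ * c := by
  have h : C ϖ ∣ F - X ^ F.natDegree := by
    rw [C_dvd_iff_dvd_coeff]
    intro i
    have h := congrArg (fun G => coeff G i) hF.map_eq_X_pow
    rw [← Ideal.mem_span_singleton, ← hϖ.maximalIdeal_eq, coeff_sub, ← Ideal.Quotient.eq]
    simp only [coeff_map] at h
    rw [h, coeff_X_pow, coeff_X_pow]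
    split_ifs <;> simp
  obtain ⟨G, hG⟩ := h
  refine ⟨aeval T G, ?_⟩
  have h2 := congrArg (aeval T) (sub_eq_iff_eq_add.mp hG)
  rw [h2]
  simp [add_comm]

namespace IsWeierstrassAlgebra

variable (h : IsWeierstrassAlgebra ϖ T)
include h

theorem not_dvd_aeval (hϖ : Irreducible ϖ) {F : O[X]}
    (hF : F.IsDistinguishedAt (maximalIdeal O)) :
    ¬ algebraMap O Λ ϖ ∣ aeval T F := by
  obtain ⟨c, hc⟩ := exists_aeval_eq_pow_add hϖ hF T
  rw [hc, dvd_add_left (dvd_mul_right _ _)]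
  exact fun hd => h.not_dvd (h.prime.dvd_of_dvd_pow hd)

theorem not_dvd_unit_mul_aeval (hϖ : Irreducible ϖ) {F : O[X]}
    (hF : F.IsDistinguishedAt (maximalIdeal O)) (u : Λˣ) :
    ¬ algebraMap O Λ ϖ ∣ u * aeval T F := by
  rw [Units.dvd_mul_left]
  exact h.not_dvd_aeval hϖ hF

theorem exists_eq_unit_mul {g : Λ} (hg : ¬ algebraMap O Λ ϖ ∣ g) : ∃ (u : Λˣ) (F : O[X]),
    F.IsDistinguishedAt (maximalIdeal O) ∧ g = u * aeval T F := by
  obtain ⟨n, u, F, hF, rfl⟩ := h.exists_eq_mul g (by rintro rfl; exact hg (dvd_zero _))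
  obtain rfl | hn := Nat.eq_zero_or_pos n
  · exact ⟨u, F, hF, by rw [pow_zero, one_mul]⟩
  · exact absurd ((dvd_pow_self _ hn.ne').mul_right _) hg

/-- The polynomial `X` is distinguished of degree one, so `Λ/(T)` is free of rank one over `O`,
hence nonzero. -/
theorem not_isUnit_T : ¬ IsUnit T := by
  intro hT
  obtain ⟨e⟩ := h.quotientEquiv X ⟨⟨fun {i} hi => by
    rw [natDegree_X, Nat.lt_one_iff] at hi
    simp [hi]⟩, monic_X⟩
  have : Subsingleton (Λ ⧸ Ideal.span {aeval T (X : O[X])}) := by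
    rw [aeval_X, Ideal.span_singleton_eq_top.mpr hT]
    exact Ideal.Quotient.subsingleton_iff.mpr rfl
  have h1 := e.injective (Subsingleton.elim (e 1) (e 0))
  exact one_ne_zero (congrFun h1 ⟨0, by rw [natDegree_X]; exact one_pos⟩)

theorem isPrime_span : (Ideal.span {algebraMap O Λ ϖ}).IsPrime :=
  (Ideal.span_singleton_prime h.prime.ne_zero).mpr h.prime

/-- The powers of `T` are distinct modulo `ϖ`: for `k > 0` the factor `1 - T^k` is a unit of the
local ring, and `ϖ` does not divide `T^i`. -/
theorem infinite_quotient [IsLocalRing Λ] : Infinite (Λ ⧸ Ideal.span {algebraMap O Λ ϖ}) := by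
  refine Infinite.of_injective (fun n : ℕ => Ideal.Quotient.mk _ (T ^ n)) ?_
  have key : ∀ i k : ℕ, (Ideal.Quotient.mk (Ideal.span {algebraMap O Λ ϖ})) (T ^ i) =
      Ideal.Quotient.mk _ (T ^ (i + k)) → k = 0 := by
    intro i k hik
    by_contra hk
    rw [Ideal.Quotient.eq, Ideal.mem_span_singleton, pow_add, ← mul_one_sub] at hik
    obtain h1 | h1 := h.prime.dvd_or_dvd hik
    · exact h.not_dvd (h.prime.dvd_of_dvd_pow h1)
    · refine h.prime.not_isUnit (isUnit_of_dvd_unit h1 ?_)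
      refine IsLocalRing.isUnit_one_sub_self_of_mem_nonunits _ fun hu => h.not_isUnit_T ?_
      exact (isUnit_pow_iff hk).mp hu
  intro i j hij
  obtain hle | hle := le_total i j
  · obtain ⟨k, rfl⟩ := Nat.exists_eq_add_of_le hle
    rw [key i k hij, add_zero]
  · obtain ⟨k, rfl⟩ := Nat.exists_eq_add_of_le hle
    rw [key j k hij.symm, add_zero]

/-- A distinguished polynomial reduces to a power of `T`, so modulo `ϖ` every nonzero element is a
unit times such a power. -/
theorem isPrincipalIdealRing_quotient (hϖ : Irreducible ϖ) :
    IsPrincipalIdealRing (Λ ⧸ Ideal.span {algebraMap O Λ ϖ}) := by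
  have := h.isPrime_span
  have key (x : Λ ⧸ Ideal.span {algebraMap O Λ ϖ}) (hx : x ≠ 0) :
      ∃ (n : ℕ) (u : (Λ ⧸ Ideal.span {algebraMap O Λ ϖ})ˣ), 
        x = u * Ideal.Quotient.mk (Ideal.span {algebraMap O Λ ϖ}) T ^ n := by
    obtain ⟨g, rfl⟩ := Ideal.Quotient.mk_surjective x
    rw [Ne, Ideal.Quotient.eq_zero_iff_dvd] at hx
    obtain ⟨u, F, hF, rfl⟩ := h.exists_eq_unit_mul hx
    refine ⟨F.natDegree, Units.map (Ideal.Quotient.mk _).toMonoidHom u, ?_⟩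
    obtain ⟨c, hc⟩ := exists_aeval_eq_pow_add hϖ hF T
    rw [hc, map_mul, map_add, map_mul, map_pow,
      Ideal.Quotient.eq_zero_iff_dvd _ _ |>.mpr (dvd_refl (algebraMap O Λ ϖ)), zero_mul, add_zero]
    rfl
  refine IsPrincipalIdealRing.of_prime fun P hP => ?_
  by_cases hbot : P = ⊥
  · rw [hbot]
    exact ⟨⟨0, by simp⟩⟩
  · obtain ⟨x, hxP, hx⟩ := Submodule.exists_mem_ne_zero_of_ne_bot hbot
    obtain ⟨n, u, rfl⟩ := key x hx
    have hT : Ideal.Quotient.mk (Ideal.span {algebraMap O Λ ϖ}) T ∈ P := by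
      rw [Ideal.unit_mul_mem_iff_mem P u.isUnit] at hxP
      exact hP.mem_of_pow_mem n hxP
    refine ⟨⟨Ideal.Quotient.mk (Ideal.span {algebraMap O Λ ϖ}) T, le_antisymm (fun y hy => ?_) ?_⟩⟩
    · by_cases hy0 : y = 0
      · rw [hy0]; exact zero_mem _
      obtain ⟨m, v, rfl⟩ := key y hy0
      obtain rfl | hm := Nat.eq_zero_or_pos m
      · rw [pow_zero, mul_one] at hy
        exact absurd (P.eq_top_of_isUnit_mem hy v.isUnit) hP.ne_top
      · exact Ideal.mem_span_singleton.mpr ((dvd_pow_self _ hm.ne').mul_left _)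
    · rw [Submodule.span_le, Set.singleton_subset_iff]
      exact hT

/-- A distinguished polynomial `F` of least degree with `F(T) ∈ P` generates `P`. A nonzero
remainder `r(T)` in `P` would be divisible by some distinguished `G(T) ∈ P`; minimality forces `deg
G > deg r`, and then `r = 0`. -/
theorem isPrincipal_of_isPrime {P : Ideal Λ} (hP : P.IsPrime) (hϖP : algebraMap O Λ ϖ ∉ P) :
    P.IsPrincipal := by
  classical
  by_cases hbot : P = ⊥
  · rw [hbot]
    exact ⟨⟨0, by simp⟩⟩
  have key (g : Λ) (hg : g ≠ 0) (hgP : g ∈ P) : ∃ F : O[X], F.IsDistinguishedAt (maximalIdeal O) ∧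
      aeval T F ∈ P ∧ aeval T F ∣ g := by
    obtain ⟨n, u, F, hF, rfl⟩ := h.exists_eq_mul g hg
    refine ⟨F, hF, ?_, ((dvd_mul_left _ _).mul_left _)⟩
    have h1 := (hP.mem_or_mem hgP).resolve_left fun h2 => hϖP (hP.mem_of_pow_mem n h2)
    rwa [Ideal.unit_mul_mem_iff_mem P u.isUnit] at h1
  have hex : ∃ n, ∃ F : O[X], F.IsDistinguishedAt (maximalIdeal O) ∧ aeval T F ∈ P ∧
      F.natDegree = n := by
    obtain ⟨x, hxP, hx⟩ := Submodule.exists_mem_ne_zero_of_ne_bot hbot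
    obtain ⟨F, hF, hFP, -⟩ := key x hx hxP
    exact ⟨_, F, hF, hFP, rfl⟩
  obtain ⟨F, hF, hFP, hdeg⟩ := Nat.find_spec hex
  refine ⟨⟨aeval T F, le_antisymm (fun g hg => ?_) ?_⟩⟩
  · obtain ⟨q, r, hr, rfl⟩ := h.exists_division F hF g
    have hrP : aeval T r ∈ P := (Ideal.add_mem_iff_right P (P.mul_mem_right q hFP)).mp hg
    refine Ideal.mem_span_singleton.mpr (dvd_add (dvd_mul_right _ _) ?_)
    by_cases hr0 : aeval T r = 0
    · rw [hr0]; exact dvd_zero _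
    obtain ⟨G, hG, hGP, hGr⟩ := key _ hr0 hrP
    by_cases hlt : r.degree < G.degree
    · rw [h.eq_zero_of_dvd G hG r hlt hGr, map_zero]
      exact dvd_zero _
    · have h1 : G.natDegree < F.natDegree :=
        natDegree_lt_natDegree hG.monic.ne_zero (lt_of_le_of_lt (not_lt.mp hlt) hr)
      rw [hdeg] at h1
      exact absurd ⟨G, hG, hGP, rfl⟩ (Nat.find_min hex h1)
  · rw [Submodule.span_le, Set.singleton_subset_iff]
    exact hFP

/-- Polynomials of degree less than `deg F` represent all classes modulo `F(T)`. -/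
theorem finite_quotient_span_pair {n : ℕ} [Finite (O ⧸ Ideal.span {ϖ ^ n})] {F : O[X]}
    (hF : F.IsDistinguishedAt (maximalIdeal O)) :
    Finite (Λ ⧸ Ideal.span {algebraMap O Λ ϖ ^ n, aeval T F}) := by
  set I := Ideal.span {algebraMap O Λ ϖ ^ n, aeval T F} with hI
  let ψ : (Fin F.natDegree → O ⧸ Ideal.span {ϖ ^ n}) → Λ ⧸ I := fun a =>
    Ideal.Quotient.mk I (∑ i, algebraMap O Λ (Quotient.out (a i)) * T ^ (i : ℕ))
  refine Finite.of_surjective ψ fun y => ?_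
  obtain ⟨g, rfl⟩ := Ideal.Quotient.mk_surjective y
  obtain ⟨q, r, hr, rfl⟩ := h.exists_division F hF g
  refine ⟨fun i => Ideal.Quotient.mk _ (r.coeff i), ?_⟩
  have hr' : aeval T r = ∑ i : Fin F.natDegree, algebraMap O Λ (r.coeff i) * T ^ (i : ℕ) := by
    by_cases hF0 : F.natDegree = 0
    · rw [degree_eq_natDegree hF.monic.ne_zero, hF0, degree_lt_iff_coeff_zero] at hr
      have hr0 : r = 0 := Polynomial.ext fun i => hr i (Nat.zero_le i)
      rw [hr0, map_zero]
      simp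
    · rw [aeval_eq_sum_range' (n := F.natDegree), Finset.sum_range]
      · simp [Algebra.smul_def]
      · rw [degree_eq_natDegree hF.monic.ne_zero] at hr
        by_cases hr0 : r = 0
        · rw [hr0, natDegree_zero]
          exact Nat.pos_of_ne_zero hF0
        · exact (natDegree_lt_iff_degree_lt hr0).mpr hr
  rw [hr', Ideal.Quotient.eq, ← Ideal.neg_mem_iff, neg_sub, add_sub_assoc, ← Finset.sum_sub_distrib]
  refine add_mem (I.mul_mem_right _ (Ideal.subset_span (by simp))) (sum_mem fun i _ => ?_)
  rw [← sub_mul, ← map_sub]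
  refine I.mul_mem_right _ ?_
  have h1 : r.coeff i - Quotient.out (Ideal.Quotient.mk (Ideal.span {ϖ ^ n}) (r.coeff i)) ∈
      Ideal.span {ϖ ^ n} := by
    rw [← Ideal.Quotient.eq]
    exact (Quotient.out_eq _).symm
  obtain ⟨c, hc⟩ := Ideal.mem_span_singleton.mp h1
  rw [hc, map_mul, map_pow]
  exact I.mul_mem_right _ (Ideal.subset_span (by simp))

/-- A finitely generated module supported at the closed point is finite. -/
theorem finite_of_forall_smul_eq_zero [hfin : ∀ n, Finite (O ⧸ Ideal.span {ϖ ^ n})]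
    {N : Type*} [AddCommGroup N] [Module Λ N] [Module.Finite Λ N]
    (h1 : ∀ x : N, ∃ n : ℕ, algebraMap O Λ ϖ ^ n • x = 0)
    (h2 : ∀ x : N, ∃ s : Λ, ¬ algebraMap O Λ ϖ ∣ s ∧ s • x = 0) : Finite N := by
  obtain ⟨k, x, hx⟩ := Module.Finite.exists_fin (R := Λ) (M := N)
  choose n hn using fun i => h1 (x i)
  choose s hs hsx using fun i => h2 (x i)
  -- Up to a unit each annihilator prime to `ϖ` is a distinguished polynomial, so `N` is a quotient
  -- of a finite sum of the finite rings `Λ/(ϖ^n, F(T))`.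
  choose u F hF hsF using fun i => h.exists_eq_unit_mul (hs i)
  have hFx (i) : aeval T (F i) • x i = 0 := by
    have := hsx i
    rwa [hsF, mul_smul, ← Units.smul_def, smul_eq_zero_iff_eq] at this
  have hfin' (i) : Finite (Λ ⧸ Ideal.span {algebraMap O Λ ϖ ^ n i, aeval T (F i)}) :=
    h.finite_quotient_span_pair (hF i)
  let ψ : (∀ i, Λ ⧸ Ideal.span {algebraMap O Λ ϖ ^ n i, aeval T (F i)}) →ₗ[Λ] N :=
    ∑ i, (Submodule.liftQ _ (LinearMap.toSpanSingleton Λ N (x i)) (by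
      rw [Submodule.span_le]
      rintro y (rfl | rfl)
      · simpa using hn i
      · simpa using hFx i)) ∘ₗ LinearMap.proj i
  refine Finite.of_surjective ψ (LinearMap.range_eq_top.mp (top_le_iff.mp ?_))
  rw [← hx, Submodule.span_le]
  rintro _ ⟨i, rfl⟩
  refine ⟨Pi.single i (Ideal.Quotient.mk _ 1), ?_⟩
  simp only [ψ, LinearMap.sum_apply, LinearMap.comp_apply, LinearMap.proj_apply]
  rw [Finset.sum_eq_single i]
  · rw [Pi.single_eq_same, ← Ideal.Quotient.mk_eq_mk, Submodule.liftQ_apply]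
    simp
  · intro j _ hj
    rw [Pi.single_eq_of_ne hj, map_zero]
  · simp

end IsWeierstrassAlgebra

end WeierstrassAlgebra

end Iwasawa

namespace Iwasawa

open Submodule

/-! ### Cyclic decompositions over a principal ideal domain. -/

section PID

/-- The structure theorem over a principal ideal domain, in terms of a family of maps to cyclic
torsion modules and a map to a free module that detects torsion. -/
theorem exists_linearMap_cyclic (R : Type*) [CommRing R] [IsDomain R] [IsPrincipalIdealRing R]
    (N : Type*) [AddCommGroup N] [Module R N] [Module.Finite R N] :
    ∃ (r n : ℕ) (q : Fin n → R) (φ₀ : N →ₗ[R] (Fin r → R))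
      (φ : ∀ i, N →ₗ[R] R ⧸ Ideal.span {q i}),
      (∀ i, q i ≠ 0 ∧ ¬ IsUnit (q i)) ∧ (∀ x, φ₀ x = 0 → x ∈ torsion R N) ∧
      (∀ x ∈ torsion R N, (∀ i, φ i x = 0) → x = 0) ∧
      ∀ y : ∀ i, R ⧸ Ideal.span {q i}, ∃ x ∈ torsion R N, ∀ i, φ i x = y i := by
  classical
  obtain ⟨r, ι, _, p, hp, e, ⟨E₀⟩⟩ := Module.equiv_free_prod_directSum (R := R) (M := N)
  let E : N ≃ₗ[R] (Fin r →₀ R) × (∀ i, R ⧸ R ∙ p i ^ e i) :=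
    E₀.trans (LinearEquiv.prodCongr (LinearEquiv.refl R _) (DirectSum.linearEquivFunOnFintype R ι _))
  -- Exponents equal to zero are discarded: their factors are trivial and would make `q i` a unit.
  let σ := Fintype.equivFin {i // e i ≠ 0}
  have htors (x : N) (hx : x ∈ torsion R N) : (E x).1 = 0 := by
    obtain ⟨a, ha⟩ := hx
    have h1 : (a : R) • (E x).1 = 0 := by
      rw [← Prod.smul_fst, ← map_smul]
      have : (a : R) • x = 0 := ha
      rw [this, map_zero]
      rfl
    exact (smul_eq_zero.mp h1).resolve_left (nonZeroDivisors.coe_ne_zero a)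
  have htors' (x : N) (hx : (E x).1 = 0) : x ∈ torsion R N := by
    refine ⟨⟨∏ i, p i ^ e i, mem_nonZeroDivisors_of_ne_zero
      (Finset.prod_ne_zero_iff.mpr fun i _ => pow_ne_zero _ (hp i).ne_zero)⟩, ?_⟩
    change (∏ i, p i ^ e i) • x = 0
    rw [← E.map_eq_zero_iff, map_smul]
    refine Prod.ext (by rw [Prod.smul_fst, hx, smul_zero]; rfl) (funext fun i => ?_)
    rw [Prod.smul_snd, Pi.smul_apply]
    obtain ⟨z, hz⟩ := Submodule.mkQ_surjective _ ((E x).2 i)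
    rw [← hz, ← map_smul]
    change Submodule.Quotient.mk _ = 0
    rw [Submodule.Quotient.mk_eq_zero, smul_eq_mul]
    exact Ideal.mul_mem_right _ _ (Ideal.mem_span_singleton.mpr
      (Finset.dvd_prod_of_mem _ (Finset.mem_univ i)))
  refine ⟨r, Fintype.card {i // e i ≠ 0}, fun k => p (σ.symm k).1 ^ e (σ.symm k).1,
    (Finsupp.linearEquivFunOnFinite R R (Fin r)).toLinearMap ∘ₗ LinearMap.fst R _ _ ∘ₗ E.toLinearMap,
    fun k => LinearMap.proj (σ.symm k).1 ∘ₗ LinearMap.snd R _ _ ∘ₗ E.toLinearMap,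
    fun k => ⟨pow_ne_zero _ (hp _).ne_zero, fun hu =>
      (hp _).not_isUnit ((isUnit_pow_iff (σ.symm k).2).mp hu)⟩, fun x hx => ?_, fun x hx h => ?_,
    fun y => ?_⟩
  · refine htors' x ((Finsupp.linearEquivFunOnFinite R R (Fin r)).map_eq_zero_iff.mp hx)
  · rw [← E.map_eq_zero_iff]
    refine Prod.ext (htors x hx) (funext fun i => ?_)
    by_cases hi : e i = 0
    · have : Subsingleton (R ⧸ R ∙ p i ^ e i) := by
        rw [hi, pow_zero]
        exact Ideal.Quotient.subsingleton_iff.mpr Ideal.span_singleton_one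
      exact Subsingleton.elim _ _
    · have := h (σ ⟨i, hi⟩)
      simp only [LinearMap.comp_apply] at this
      have key : ∀ k : {i // e i ≠ 0}, k = ⟨i, hi⟩ → (E x).2 k.1 = 0 → (E x).2 i = 0 := by
        rintro k rfl h
        exact h
      exact key _ (σ.symm_apply_apply _) this
  · let z : ∀ i, R ⧸ R ∙ p i ^ e i := fun i =>
      if hi : e i ≠ 0 then (σ.symm_apply_apply ⟨i, hi⟩ ▸ y (σ ⟨i, hi⟩) :
        R ⧸ R ∙ p (⟨i, hi⟩ : {i // e i ≠ 0}).1 ^ e (⟨i, hi⟩ : {i // e i ≠ 0}).1) else 0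
    have hz : ∀ k, z (σ.symm k).1 = y k := by
      intro k
      have key : ∀ (j : {i // e i ≠ 0}) (k) (hk : σ j = k) (h : σ.symm k = j), z j.1 = h ▸ y k := by
        rintro j k rfl h
        simp only [z]
        rw [dif_pos j.2]
      exact key _ k (σ.apply_symm_apply k) rfl
    refine ⟨E.symm (0, z), htors' _ (by simp), fun k => ?_⟩
    simpa using hz k

end PID

/-! ### Descending cyclic decompositions from a localization. -/

section Localization

variable {Λ : Type*} [CommRing Λ]

/-- It suffices that prime ideals be principal, and those of the localization are extended from
primes disjoint from `S`. -/
theorem isPrincipalIdealRing_localization (S : Submonoid Λ)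
    (h : ∀ P : Ideal Λ, P.IsPrime → Disjoint (S : Set Λ) P → P.IsPrincipal) :
    IsPrincipalIdealRing (Localization S) := by
  refine IsPrincipalIdealRing.of_prime fun P hP => ?_
  have hd := (IsLocalization.isPrime_iff_isPrime_disjoint S (Localization S) P).mp hP
  obtain ⟨⟨a, ha⟩⟩ := h _ hd.1 hd.2
  refine ⟨⟨algebraMap Λ _ a, ?_⟩⟩
  rw [← IsLocalization.map_under S (Localization S) P, ha]
  exact (Ideal.map_span _ _).trans (by rw [Set.image_singleton])

variable [IsDomain Λ] [IsNoetherianRing Λ] {M : Type*} [AddCommGroup M] [Module Λ M] [Module.Finite Λ M]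

/-- If the localization at `S` is principal, then the torsion of a finitely generated module is,
up to `S`-torsion, a sum of cyclic modules. -/
theorem exists_linearMap_of_localization (S : Submonoid Λ) (hS : (0 : Λ) ∉ S)
    [IsPrincipalIdealRing (Localization S)] (G : Set Λ)
    (hG : ∀ q : Localization S, q ≠ 0 → ∃ g ∈ G, Associated (algebraMap Λ _ g) q) :
    ∃ (r n : ℕ) (g : Fin n → Λ) (f₀ : M →ₗ[Λ] (Fin r → Λ))
      (f : M →ₗ[Λ] (∀ i, Λ ⧸ Ideal.span {g i})),
      (∀ i, g i ∈ G ∧ ¬ IsUnit (algebraMap Λ (Localization S) (g i))) ∧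
      (∀ m, f₀ m = 0 → m ∈ torsion Λ M) ∧
      (∀ m ∈ torsion Λ M, f m = 0 → ∃ s ∈ S, s • m = 0) ∧
      ∀ e, ∃ s ∈ S, ∃ m ∈ torsion Λ M, f m = s • e := by
  have hS' : S ≤ nonZeroDivisors Λ := le_nonZeroDivisors_of_noZeroDivisors hS
  have : IsDomain (Localization S) := IsLocalization.isDomain_localization hS'
  set R := Localization S with hR
  set N := LocalizedModule S M
  let ι : M →ₗ[Λ] N := LocalizedModule.mkLinearMap S M
  obtain ⟨r, n, q, φ₀, φ, hq, h₀, hker, hsurj⟩ := exists_linearMap_cyclic R N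
  choose g hgG hg using fun i => hG (q i) (hq i).1
  have hspan (i) : Ideal.span {q i} = (Ideal.span {g i}).localized' R S (Algebra.linearMap Λ R) := by
    rw [Ideal.localized'_eq_map, Ideal.map_span, Set.image_singleton, Ideal.span_singleton_eq_span_singleton]
    exact (hg i).symm
  -- torsion and localization
  have htors (m : M) (hm : m ∈ torsion Λ M) : ι m ∈ torsion R N := by
    obtain ⟨a, ha⟩ := hm
    have ha : (a : Λ) • m = 0 := ha
    refine ⟨⟨algebraMap Λ R a, mem_nonZeroDivisors_of_ne_zero ?_⟩, ?_⟩
    · rw [Ne, IsLocalization.to_map_eq_zero_iff R hS']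
      exact nonZeroDivisors.coe_ne_zero a
    · change algebraMap Λ R a • ι m = 0
      rw [algebraMap_smul, ← map_smul, ha, map_zero]
  have htors' (m : M) (hm : ι m ∈ torsion R N) : m ∈ torsion Λ M := by
    obtain ⟨⟨a, ha0⟩, ha⟩ := hm
    have ha : a • ι m = 0 := ha
    obtain ⟨⟨b, s⟩, hb⟩ := IsLocalization.surj S a
    have h1 : b • ι m = 0 := by
      rw [← algebraMap_smul R b, ← hb, mul_comm, mul_smul, ha, smul_zero]
    rw [← map_smul] at h1
    obtain ⟨t, ht⟩ := (IsLocalizedModule.eq_zero_iff S ι).mp h1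
    have ht : (t : Λ) • b • m = 0 := ht
    rw [smul_smul] at ht
    refine ⟨⟨t * b, mul_mem (hS' t.2) (mem_nonZeroDivisors_of_ne_zero ?_)⟩, ht⟩
    rintro rfl
    rw [map_zero, mul_eq_zero] at hb
    obtain h | h := hb
    · exact nonZeroDivisors.ne_zero ha0 h
    · exact nonZeroDivisors.ne_zero (hS' s.2) ((IsLocalization.to_map_eq_zero_iff R hS').mp h)
  have : Module.FinitePresentation Λ M := Module.finitePresentation_of_finite Λ M
  -- lift the map to the free module
  choose f₀ s₀ hf₀ using fun j : Fin r => Module.FinitePresentation.exists_lift_of_isLocalizedModule S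
    (Algebra.linearMap Λ R) (((LinearMap.proj j ∘ₗ φ₀).restrictScalars Λ) ∘ₗ ι)
  -- lift the maps to the cyclic modules
  let J (i) := (Ideal.span {g i}).toLocalizedQuotient' R S (Algebra.linearMap Λ R)
  let φ' (i) : N →ₗ[R] R ⧸ (Ideal.span {g i}).localized' R S (Algebra.linearMap Λ R) :=
    (Submodule.quotEquivOfEq _ _ (hspan i)).toLinearMap ∘ₗ φ i
  have hφ' (i x) : φ' i x = 0 ↔ φ i x = 0 :=
    (Submodule.quotEquivOfEq _ _ (hspan i)).map_eq_zero_iff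
  choose f s hf using fun i => Module.FinitePresentation.exists_lift_of_isLocalizedModule S
    (J i) ((φ' i).restrictScalars Λ ∘ₗ ι)
  have hf' (i) (m : M) : J i (f i m) = (s i : Λ) • φ' i (ι m) := LinearMap.congr_fun (hf i) m
  refine ⟨r, n, g, LinearMap.pi f₀, LinearMap.pi f, fun i => ⟨hgG i, ?_⟩, fun m hm => ?_,
    fun m hm hfm => ?_, fun e => ?_⟩
  · rw [(hg i).isUnit_iff]
    exact (hq i).2
  · refine htors' m (h₀ _ (funext fun j => ?_))
    have h1 := LinearMap.congr_fun (hf₀ j) m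
    have h2 : f₀ j m = 0 := congrFun hm j
    rw [LinearMap.comp_apply, h2, map_zero] at h1
    have h3 : algebraMap Λ R (s₀ j) * φ₀ (ι m) j = 0 := by
      rw [← Algebra.smul_def]
      exact h1.symm
    exact (mul_eq_zero.mp h3).resolve_left (IsLocalization.map_units R (s₀ j)).ne_zero
  · have h1 : ι m = 0 := by
      refine hker _ (htors m hm) fun i => ?_
      have h2 : f i m = 0 := congrFun hfm i
      have h3 := hf' i m
      rw [h2, map_zero, ← algebraMap_smul R] at h3
      rw [← hφ']
      exact ((IsLocalization.map_units R (s i)).smul_eq_zero).mp h3.symm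
    obtain ⟨t, ht⟩ := (IsLocalizedModule.eq_zero_iff S ι).mp h1
    exact ⟨t, t.2, ht⟩
  · -- solve the equation after localization
    have hu (i) : ∃ v : R, algebraMap Λ R (s i) * v = 1 := (IsLocalization.map_units R (s i)).exists_right_inv
    choose v hv using hu
    -- After localization `f i` is `s i` times the `i`-th cyclic map, so the target is first
    -- multiplied by the inverse `v i` of `s i`.
    obtain ⟨y, hy, hφy⟩ := hsurj fun i => v i • (Submodule.quotEquivOfEq _ _ (hspan i)).symm (J i (e i))
    obtain ⟨⟨m, t⟩, hm⟩ := IsLocalizedModule.surj S ι y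
    have hm : (t : Λ) • y = ι m := hm
    have hmt : m ∈ torsion Λ M := by
      refine htors' m ?_
      rw [← hm, ← algebraMap_smul R]
      exact (torsion R N).smul_mem _ hy
    have h1 (i) : J i (f i m) = J i ((t : Λ) • e i) := by
      rw [hf', ← hm, ← algebraMap_smul R (t : Λ), map_smul, ← algebraMap_smul R (s i : Λ)]
      simp only [φ', LinearMap.comp_apply, hφy, LinearEquiv.coe_coe, map_smul,
        LinearEquiv.apply_symm_apply]
      rw [smul_comm, smul_smul (algebraMap Λ R (s i)), hv, one_smul, algebraMap_smul]
    choose w hw using fun i => IsLocalizedModule.exists_of_eq (S := S) (h1 i)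
    -- Each coordinate agrees only after multiplication by its own `w i`; the product serves all of
    -- them.
    refine ⟨(∏ i, (w i : Λ)) * t, mul_mem (prod_mem fun i _ => (w i).2) t.2,
      (∏ i, (w i : Λ)) • m, (torsion Λ M).smul_mem _ hmt, funext fun i => ?_⟩
    have h2 : (w i : Λ) • f i m = (w i : Λ) • (t : Λ) • e i := hw i
    rw [map_smul, Pi.smul_apply, Pi.smul_apply, LinearMap.pi_apply, mul_smul]
    rw [← Finset.prod_erase_mul _ _ (Finset.mem_univ i), mul_smul, mul_smul, h2]

end Localization

end Iwasawa

namespace Iwasawa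

open Submodule

/-! ### Making the cokernel of the free part finite. -/

section Saturation

variable {Λ : Type*} [CommRing Λ] {π : Λ} (hπ : Prime π) {r : ℕ}

/-- The saturation of a submodule `N` of a free module: the elements `x` for
which `π^n x` and `h x` lie in `N` for some `n` and some `h` prime to `π`. -/
def saturation (N : Submodule Λ (Fin r → Λ)) : Submodule Λ (Fin r → Λ) where
  carrier := {x | (∃ n : ℕ, π ^ n • x ∈ N) ∧ ∃ h : Λ, ¬ π ∣ h ∧ h • x ∈ N}
  zero_mem' := ⟨⟨0, by simp⟩, 1, hπ.not_dvd_one, by simp⟩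
  add_mem' := by
    rintro x y ⟨⟨m, hm⟩, a, ha, hax⟩ ⟨⟨n, hn⟩, b, hb, hby⟩
    refine ⟨⟨m + n, ?_⟩, a * b, fun hd => (hπ.dvd_or_dvd hd).elim ha hb, ?_⟩
    · rw [smul_add]
      refine add_mem ?_ ?_
      · rw [add_comm, pow_add, mul_smul]
        exact N.smul_mem _ hm
      · rw [pow_add, mul_smul]
        exact N.smul_mem _ hn
    · rw [smul_add]
      refine add_mem ?_ ?_
      · rw [mul_comm, mul_smul]
        exact N.smul_mem _ hax
      · rw [mul_smul]
        exact N.smul_mem _ hby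
  smul_mem' := by
    rintro c x ⟨⟨m, hm⟩, a, ha, hax⟩
    refine ⟨⟨m, ?_⟩, a, ha, ?_⟩
    · rw [smul_comm]; exact N.smul_mem _ hm
    · rw [smul_comm]; exact N.smul_mem _ hax

theorem le_saturation (N : Submodule Λ (Fin r → Λ)) : N ≤ saturation hπ N := fun x hx =>
  ⟨⟨0, by simpa using hx⟩, 1, hπ.not_dvd_one, by simpa using hx⟩

variable [IsDomain Λ]

/-- Primality of `π` lets `x` be divided by `π` in the free module. The quotient `z` stays in the
saturation because `h • z = y` and a multiple of `y` by an element prime to `π` lies in `N`. -/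
theorem exists_eq_smul_of_smul_eq (N : Submodule Λ (Fin r → Λ)) {h : Λ} (hh : ¬ π ∣ h)
    {x y : saturation hπ N} (hxy : h • x = π • y) : ∃ z : saturation hπ N, x = π • z := by
  obtain ⟨x, ⟨n, hn⟩, hx⟩ := x
  obtain ⟨y, hy, ⟨a, ha, hay⟩⟩ := y
  have hxy' : h • x = π • y := congrArg Subtype.val hxy
  have hdvd (i) : π ∣ x i := by
    have := congrFun hxy' i
    exact (hπ.dvd_or_dvd (Dvd.intro _ this.symm)).resolve_left hh
  choose z hz using hdvd
  have hz' : x = π • z := funext hz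
  have hhz : h • z = y := by
    apply smul_right_injective _ hπ.ne_zero
    change π • h • z = π • y
    rw [← hxy', hz', smul_comm]
  refine ⟨⟨z, ⟨n + 1, ?_⟩, a * h, fun hd => (hπ.dvd_or_dvd hd).elim ha hh, ?_⟩, Subtype.ext hz'⟩
  · rwa [pow_succ, mul_smul, ← hz']
  · rwa [mul_smul, hhz]

/-- Modulo `π` the saturation is torsion-free over a principal ideal domain, hence free. Freeness
lifts because `π` is regular on the module and lies in the Jacobson radical. -/
theorem free_saturation [IsNoetherianRing Λ] [IsLocalRing Λ]
    [IsPrincipalIdealRing (Λ ⧸ Ideal.span {π})] (N : Submodule Λ (Fin r → Λ)) :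
    Module.Free Λ (saturation hπ N) := by
  have : (Ideal.span {π}).IsPrime := (Ideal.span_singleton_prime hπ.ne_zero).mpr hπ
  have : Module.FinitePresentation Λ (saturation hπ N) := Module.finitePresentation_of_finite _ _
  have hreg : IsSMulRegular (saturation hπ N) π := by
    intro x y hxy
    exact Subtype.ext (smul_right_injective _ hπ.ne_zero (congrArg Subtype.val hxy))
  have hjac : π ∈ (⊥ : Ideal Λ).jacobson := by
    rw [IsLocalRing.jacobson_eq_maximalIdeal ⊥ bot_ne_top]
    exact hπ.not_isUnit
  rw [← Module.free_quotSMulTop_iff_free Λ _ hjac hreg]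
  have := Module.Finite.of_restrictScalars_finite Λ (Λ ⧸ Ideal.span {π})
    (QuotSMulTop π (saturation hπ N))
  have : Module.IsTorsionFree (Λ ⧸ Ideal.span {π}) (QuotSMulTop π (saturation hπ N)) := by
    rw [Submodule.isTorsionFree_iff_torsion_eq_bot, eq_bot_iff]
    rintro x ⟨⟨a, ha0⟩, ha⟩
    obtain ⟨a, rfl⟩ := Ideal.Quotient.mk_surjective a
    obtain ⟨x, rfl⟩ := Submodule.Quotient.mk_surjective _ x
    have ha' : Submodule.Quotient.mk (a • x) = (0 : QuotSMulTop π (saturation hπ N)) := ha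
    rw [Submodule.Quotient.mk_eq_zero, Submodule.mem_smul_pointwise_iff_exists] at ha'
    obtain ⟨y, -, hy⟩ := ha'
    have hadvd : ¬ π ∣ a := by
      rw [← Ideal.Quotient.eq_zero_iff_dvd]
      exact nonZeroDivisors.ne_zero ha0
    obtain ⟨z, rfl⟩ := exists_eq_smul_of_smul_eq hπ N hadvd hy.symm
    rw [Submodule.mem_bot, Submodule.Quotient.mk_eq_zero]
    exact Submodule.smul_mem_pointwise_smul _ _ _ trivial
  infer_instance

/-- A map to a free module can be replaced, without changing its kernel, by one with finite
cokernel. -/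
theorem exists_linearMap_free (hπ : Prime π) [IsNoetherianRing Λ] [IsLocalRing Λ]
    [IsPrincipalIdealRing (Λ ⧸ Ideal.span {π})] {M : Type*} [AddCommGroup M] [Module Λ M]
    (f₀ : M →ₗ[Λ] (Fin r → Λ)) : ∃ (k : ℕ) (f : M →ₗ[Λ] (Fin k → Λ)),
      (∀ m, f m = 0 → f₀ m = 0) ∧ ∀ e, (∃ (n : ℕ) (m : M), f m = π ^ n • e) ∧
        ∃ s, ¬ π ∣ s ∧ ∃ m, f m = s • e := by
  have := free_saturation hπ (LinearMap.range f₀)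
  let b := Module.finBasis Λ (saturation hπ (LinearMap.range f₀))
  let g : M →ₗ[Λ] saturation hπ (LinearMap.range f₀) :=
    f₀.codRestrict _ fun m => le_saturation hπ _ ⟨m, rfl⟩
  refine ⟨_, b.equivFun.toLinearMap ∘ₗ g, fun m hm => ?_, fun e => ?_⟩
  · have := b.equivFun.map_eq_zero_iff.mp hm
    exact congrArg Subtype.val this
  · obtain ⟨x, rfl⟩ := b.equivFun.surjective e
    obtain ⟨⟨n, m, hm⟩, s, hs, m', hm'⟩ := x.2
    refine ⟨⟨n, m, ?_⟩, s, hs, m', ?_⟩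
    · rw [← map_smul]
      exact congrArg b.equivFun (Subtype.ext hm)
    · rw [← map_smul]
      exact congrArg b.equivFun (Subtype.ext hm')

end Saturation

end Iwasawa

namespace Iwasawa

open IsLocalRing Polynomial Submodule

section Elementary

variable {O Λ : Type*} [CommRing O] [CommRing Λ] [Algebra O Λ]

theorem prod_aeval_smul_eq_zero {T : Λ} {t : ℕ} (F : Fin t → O[X])
    (e : ∀ i, Λ ⧸ Ideal.span {aeval T (F i)}) : (∏ i, aeval T (F i)) • e = 0 := by
  funext i
  obtain ⟨x, hx⟩ := Ideal.Quotient.mk_surjective (e i)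
  rw [Pi.smul_apply, ← hx, ← Ideal.Quotient.mk_eq_mk, ← Submodule.Quotient.mk_smul, smul_eq_mul]
  refine (Submodule.Quotient.mk_eq_zero _).mpr (Ideal.mul_mem_right _ _ ?_)
  exact Ideal.mem_span_singleton.mpr (Finset.dvd_prod_of_mem _ (Finset.mem_univ i))

theorem pow_sum_smul_eq_zero {ϖ : O} {s : ℕ} (a : Fin s → ℕ)
    (e : ∀ i, Λ ⧸ Ideal.span {algebraMap O Λ ϖ ^ a i}) :
    (algebraMap O Λ ϖ ^ ∑ i, a i) • e = 0 := by
  funext i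
  obtain ⟨x, hx⟩ := Ideal.Quotient.mk_surjective (e i)
  rw [Pi.smul_apply, ← hx, ← Ideal.Quotient.mk_eq_mk, ← Submodule.Quotient.mk_smul, smul_eq_mul]
  refine (Submodule.Quotient.mk_eq_zero _).mpr (Ideal.mul_mem_right _ _ ?_)
  exact Ideal.mem_span_singleton.mpr
    (pow_dvd_pow _ (Finset.single_le_sum (fun _ _ => Nat.zero_le _) (Finset.mem_univ i)))

end Elementary

/-! ### Existence of the decomposition. -/

section Existence

variable {O Λ : Type*} [CommRing O] [IsDomain O] [IsDiscreteValuationRing O]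
  [CommRing Λ] [IsDomain Λ] [IsNoetherianRing Λ] [Algebra O Λ] {ϖ : O} {T : Λ}
  (h : IsWeierstrassAlgebra ϖ T)
  {M : Type*} [AddCommGroup M] [Module Λ M] [Module.Finite Λ M]

namespace IsWeierstrassAlgebra

include h in
/-- Inverting `ϖ` describes the torsion of `M` away from `ϖ`. -/
theorem exists_linearMap_distinguished :
    ∃ (r t : ℕ) (F : Fin t → O[X]) (f₀ : M →ₗ[Λ] (Fin r → Λ))
      (f : M →ₗ[Λ] (∀ i, Λ ⧸ Ideal.span {aeval T (F i)})),
      (∀ i, (F i).IsDistinguishedAt (maximalIdeal O)) ∧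
      (∀ m, f₀ m = 0 → m ∈ torsion Λ M) ∧
      (∀ m ∈ torsion Λ M, f m = 0 → ∃ n : ℕ, algebraMap O Λ ϖ ^ n • m = 0) ∧
      ∀ e, ∃ n : ℕ, ∃ m ∈ torsion Λ M, f m = algebraMap O Λ ϖ ^ n • e := by
  set S := Submonoid.powers (algebraMap O Λ ϖ) with hSdef
  have hS : (0 : Λ) ∉ S := by
    rintro ⟨n, hn⟩
    exact pow_ne_zero n h.prime.ne_zero hn
  have hS' : S ≤ nonZeroDivisors Λ := le_nonZeroDivisors_of_noZeroDivisors hS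
  have : IsPrincipalIdealRing (Localization S) := by
    refine isPrincipalIdealRing_localization S fun P hP hd => h.isPrincipal_of_isPrime hP fun hϖP => ?_
    exact Set.disjoint_left.mp hd (Submonoid.mem_powers _) hϖP
  obtain ⟨r, t, g, f₀, f, hg, h₀, hker, hcoker⟩ := exists_linearMap_of_localization (M := M) S hS
    {g | ∃ F : O[X], F.IsDistinguishedAt (maximalIdeal O) ∧ aeval T F = g} (by
      intro q hq
      obtain ⟨a, s, rfl⟩ := IsLocalization.exists_mk'_eq S q
      have ha : a ≠ 0 := by
        rintro rfl
        exact hq (IsLocalization.mk'_zero s)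
      obtain ⟨n, u, F, hF, rfl⟩ := h.exists_eq_mul a ha
      refine ⟨_, ⟨F, hF, rfl⟩, ?_⟩
      have hu1 : IsUnit (algebraMap Λ (Localization S) (algebraMap O Λ ϖ ^ n)) :=
        IsLocalization.map_units (Localization S) (⟨_, n, rfl⟩ : S)
      have hu2 : IsUnit (algebraMap Λ (Localization S) u) := u.isUnit.map _
      have hu3 : IsUnit (algebraMap Λ (Localization S) s) := IsLocalization.map_units _ s
      have h1 : algebraMap Λ (Localization S) (algebraMap O Λ ϖ ^ n * (u * aeval T F)) =
          (hu1.unit * hu2.unit : (Localization S)ˣ) * algebraMap Λ (Localization S) (aeval T F) := by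
        simp [mul_assoc]
      have h2 : Associated (IsLocalization.mk' (Localization S)
          (algebraMap O Λ ϖ ^ n * (u * aeval T F)) s)
          (algebraMap Λ (Localization S) (algebraMap O Λ ϖ ^ n * (u * aeval T F))) :=
        ⟨hu3.unit, by rw [IsUnit.unit_spec, IsLocalization.mk'_spec]⟩
      refine Associated.symm (h2.trans ?_)
      rw [h1]
      exact associated_unit_mul_left _ _ (Units.isUnit _))
  choose F hF hFg using fun i => (hg i).1
  obtain rfl : (fun i => aeval T (F i)) = g := funext hFg
  refine ⟨r, t, F, f₀, f, hF, h₀, fun m hm hfm => ?_, fun e => ?_⟩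
  · obtain ⟨_, ⟨n, rfl⟩, hn⟩ := hker m hm hfm
    exact ⟨n, hn⟩
  · obtain ⟨_, ⟨n, rfl⟩, hn⟩ := hcoker e
    exact ⟨n, hn⟩

include h in
/-- Localizing at `ϖ` describes the `ϖ`-primary part of the torsion of `M`. -/
theorem exists_linearMap_pow (hϖ : Irreducible ϖ) :
    ∃ (s : ℕ) (a : Fin s → ℕ)
      (f : M →ₗ[Λ] (∀ i, Λ ⧸ Ideal.span {algebraMap O Λ ϖ ^ a i})),
      (∀ i, 1 ≤ a i) ∧
      (∀ m ∈ torsion Λ M, f m = 0 → ∃ s, ¬ algebraMap O Λ ϖ ∣ s ∧ s • m = 0) ∧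
      ∀ e, ∃ s, ¬ algebraMap O Λ ϖ ∣ s ∧ ∃ m ∈ torsion Λ M, f m = s • e := by
  have := h.isPrime_span
  set S := (Ideal.span {algebraMap O Λ ϖ}).primeCompl with hSdef
  have hmem (x : Λ) : x ∈ S ↔ ¬ algebraMap O Λ ϖ ∣ x := by
    rw [hSdef, Ideal.mem_primeCompl_iff, Ideal.mem_span_singleton]
  have hS : (0 : Λ) ∉ S := by
    rw [hmem, not_not]
    exact dvd_zero _
  have : IsPrincipalIdealRing (Localization S) := by
    refine isPrincipalIdealRing_localization S fun P hP hd => ?_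
    by_cases hbot : P = ⊥
    · rw [hbot]
      exact ⟨⟨0, by simp⟩⟩
    obtain ⟨x, hxP, hx⟩ := Submodule.exists_mem_ne_zero_of_ne_bot hbot
    obtain ⟨n, u, F, hF, rfl⟩ := h.exists_eq_mul x hx
    have h1 : algebraMap O Λ ϖ ∈ P := by
      refine hP.mem_of_pow_mem n ((hP.mem_or_mem hxP).resolve_right fun h2 => ?_)
      exact Set.disjoint_left.mp hd ((hmem _).mpr (h.not_dvd_unit_mul_aeval hϖ hF u)) h2
    refine ⟨⟨algebraMap O Λ ϖ, le_antisymm (fun y hy => ?_) ?_⟩⟩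
    · by_contra hny
      refine Set.disjoint_left.mp hd ((hmem y).mpr fun hd => hny ?_) hy
      exact Ideal.mem_span_singleton.mpr hd
    · rw [Submodule.span_le, Set.singleton_subset_iff]
      exact h1
  obtain ⟨r, t, g, f₀, f, hg, h₀, hker, hcoker⟩ := exists_linearMap_of_localization (M := M) S hS
    {g | ∃ n : ℕ, algebraMap O Λ ϖ ^ n = g} (by
      intro q hq
      obtain ⟨a, s, rfl⟩ := IsLocalization.exists_mk'_eq S q
      have ha : a ≠ 0 := by
        rintro rfl
        exact hq (IsLocalization.mk'_zero s)
      obtain ⟨n, u, F, hF, rfl⟩ := h.exists_eq_mul a ha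
      refine ⟨_, ⟨n, rfl⟩, ?_⟩
      have hu2 : IsUnit (algebraMap Λ (Localization S) (u * aeval T F)) :=
        IsLocalization.map_units (Localization S)
          (⟨_, (hmem _).mpr (h.not_dvd_unit_mul_aeval hϖ hF u)⟩ : S)
      have hu3 : IsUnit (algebraMap Λ (Localization S) s) := IsLocalization.map_units _ s
      have h2 : Associated (IsLocalization.mk' (Localization S)
          (algebraMap O Λ ϖ ^ n * (u * aeval T F)) s)
          (algebraMap Λ (Localization S) (algebraMap O Λ ϖ ^ n * (u * aeval T F))) :=
        ⟨hu3.unit, by rw [IsUnit.unit_spec, IsLocalization.mk'_spec]⟩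
      refine Associated.symm (h2.trans ?_)
      rw [map_mul]
      exact associated_mul_unit_left _ _ hu2)
  choose a ha using fun i => (hg i).1
  obtain rfl : (fun i => algebraMap O Λ ϖ ^ a i) = g := funext ha
  refine ⟨t, a, f, fun i => ?_, fun m hm hfm => ?_, fun e => ?_⟩
  · by_contra h0
    have h0 : a i = 0 := by omega
    refine (hg i).2 ?_
    simp [h0]
  · obtain ⟨s, hs, hn⟩ := hker m hm hfm
    exact ⟨s, (hmem s).mp hs, hn⟩
  · obtain ⟨s, hs, hn⟩ := hcoker e
    exact ⟨s, (hmem s).mp hs, hn⟩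

include h in
/-- The structure theorem up to pseudo-isomorphism. -/
theorem exists_isPseudoIso [IsLocalRing Λ] (hϖ : Irreducible ϖ) [hfin : ∀ n, Finite (O ⧸ Ideal.span {ϖ ^ n})] :
    ∃ (r s t : ℕ) (a : Fin s → ℕ) (F : Fin t → O[X]), (∀ i, 1 ≤ a i) ∧
      (∀ j, (F j).IsDistinguishedAt (maximalIdeal O)) ∧
      ∃ φ : M →ₗ[Λ] (Fin r → Λ) × (∀ i, Λ ⧸ Ideal.span {algebraMap O Λ ϖ ^ a i}) ×
        (∀ j, Λ ⧸ Ideal.span {aeval T (F j)}), IsPseudoIso φ := by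
  obtain ⟨r₀, t, F, f₀, f₁, hF, h₀, hker₁, hcoker₁⟩ := h.exists_linearMap_distinguished (M := M)
  obtain ⟨s, a, f₂, ha, hker₂, hcoker₂⟩ := h.exists_linearMap_pow (M := M) hϖ
  have := h.isPrincipalIdealRing_quotient hϖ
  obtain ⟨r, f₃, hker₃, hcoker₃⟩ := exists_linearMap_free h.prime f₀
  have hprod : ¬ algebraMap O Λ ϖ ∣ ∏ j, aeval T (F j) := fun hd => by
    obtain ⟨j, -, hj⟩ := (h.prime.dvd_finsetProd_iff _).mp hd
    exact h.not_dvd_aeval hϖ (hF j) hj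
  have hmul {x y : Λ} (hx : ¬ algebraMap O Λ ϖ ∣ x) (hy : ¬ algebraMap O Λ ϖ ∣ y) : ¬ algebraMap O Λ ϖ ∣ x * y := fun hd =>
    (h.prime.dvd_or_dvd hd).elim hx hy
  refine ⟨r, s, t, a, F, ha, hF, f₃.prod (f₂.prod f₁), ?_, ?_⟩
  · refine h.finite_of_forall_smul_eq_zero (fun ⟨m, hm⟩ => ?_) (fun ⟨m, hm⟩ => ?_)
    · have h1 := congrArg Prod.fst hm
      have h2 := congrArg (fun x => x.2.2) hm
      obtain ⟨n, hn⟩ := hker₁ m (h₀ m (hker₃ m h1)) h2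
      exact ⟨n, Subtype.ext hn⟩
    · have h1 := congrArg Prod.fst hm
      have h2 := congrArg (fun x => x.2.1) hm
      obtain ⟨x, hx, hn⟩ := hker₂ m (h₀ m (hker₃ m h1)) h2
      exact ⟨x, hx, Subtype.ext hn⟩
  · -- torsion elements map to zero in the free part
    have htors (m : M) (hm : m ∈ torsion Λ M) : f₃ m = 0 := by
      obtain ⟨c, hc⟩ := hm
      have hc : (c : Λ) • m = 0 := hc
      have h1 : (c : Λ) • f₃ m = 0 := by rw [← map_smul, hc, map_zero]
      exact (smul_eq_zero.mp h1).resolve_left (nonZeroDivisors.coe_ne_zero c)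
    refine h.finite_of_forall_smul_eq_zero (fun x => ?_) (fun x => ?_)
    · obtain ⟨⟨e₃, e₂, e₁⟩, rfl⟩ := Submodule.Quotient.mk_surjective _ x
      obtain ⟨⟨n, m, hm⟩, -⟩ := hcoker₃ e₃
      obtain ⟨n', m', hm', hm'f⟩ := hcoker₁ (algebraMap O Λ ϖ ^ n • e₁ - f₁ m)
      set k := ∑ i, a i
      -- The factor `ϖ^n` lifts `e₃` to some `m`, `ϖ^n'` makes the discrepancy in the `F`-part
      -- liftable by a torsion `m'`, which leaves the free part alone, and `ϖ^k` kills the `ϖ`-part.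
      refine ⟨k + n' + n, ?_⟩
      rw [← Submodule.Quotient.mk_smul]
      refine (Submodule.Quotient.mk_eq_zero _).mpr ⟨(algebraMap O Λ ϖ ^ (k + n')) • m + algebraMap O Λ ϖ ^ k • m', ?_⟩
      refine Prod.ext ?_ (Prod.ext ?_ ?_)
      · change f₃ _ = algebraMap O Λ ϖ ^ (k + n' + n) • e₃
        rw [map_add, map_smul, map_smul, htors m' hm', smul_zero, add_zero, hm, smul_smul,
          ← pow_add]
      · change f₂ _ = algebraMap O Λ ϖ ^ (k + n' + n) • e₂
        rw [map_add, map_smul, map_smul, pow_sum_smul_eq_zero, add_zero, pow_add, mul_comm, mul_smul,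
          pow_sum_smul_eq_zero, smul_zero, pow_add, mul_comm, mul_smul, pow_add, mul_comm (algebraMap O Λ ϖ ^ k),
          mul_smul, pow_sum_smul_eq_zero, smul_zero, smul_zero]
      · change f₁ _ = algebraMap O Λ ϖ ^ (k + n' + n) • e₁
        rw [map_add, map_smul, map_smul, hm'f, smul_smul, ← pow_add, smul_sub, smul_smul, ← pow_add]
        abel
    · obtain ⟨⟨e₃, e₂, e₁⟩, rfl⟩ := Submodule.Quotient.mk_surjective _ x
      obtain ⟨-, n, hn, m, hm⟩ := hcoker₃ e₃
      obtain ⟨n', hn', m', hm', hm'f⟩ := hcoker₂ (n • e₂ - f₂ m)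
      set k := ∏ j, aeval T (F j)
      -- The same correction with roles exchanged: the discrepancy sits in the `ϖ`-part, and `k`,
      -- the product of the `F_j(T)`, kills the `F`-part.
      refine ⟨k * (n' * n), hmul hprod (hmul hn' hn), ?_⟩
      rw [← Submodule.Quotient.mk_smul]
      refine (Submodule.Quotient.mk_eq_zero _).mpr ⟨(k * n') • m + k • m', ?_⟩
      refine Prod.ext ?_ (Prod.ext ?_ ?_)
      · change f₃ _ = (k * (n' * n)) • e₃
        rw [map_add, map_smul, map_smul, htors m' hm', smul_zero, add_zero, hm, smul_smul,
          mul_assoc]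
      · change f₂ _ = (k * (n' * n)) • e₂
        rw [map_add, map_smul, map_smul, hm'f, mul_smul, ← smul_add, ← smul_add, mul_smul, mul_smul,
          add_sub_cancel]
      · change f₁ _ = (k * (n' * n)) • e₁
        rw [map_add, map_smul, map_smul, mul_smul, prod_aeval_smul_eq_zero, prod_aeval_smul_eq_zero,
          mul_smul, prod_aeval_smul_eq_zero, add_zero]

end IsWeierstrassAlgebra

end Existence

end Iwasawa

namespace Iwasawa

open IsLocalRing Polynomial Submodule

/-! ### Local lengths of torsion submodules. -/

section Torsion

theorem map_mem_torsion {Λ : Type*} [CommRing Λ] {X Y : Type*} [AddCommGroup X] [Module Λ X]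
    [AddCommGroup Y] [Module Λ Y] (k : X →ₗ[Λ] Y) {x : X} (hx : x ∈ torsion Λ X) :
    k x ∈ torsion Λ Y := by
  obtain ⟨a, ha⟩ := hx
  have ha : (a : Λ) • x = 0 := ha
  refine ⟨a, ?_⟩
  change (a : Λ) • k x = 0
  rw [← map_smul, ha, map_zero]

/-- The local length of the torsion is additive when the submodule is torsion. -/
theorem localLength_torsion_add {Λ : Type*} [CommRing Λ] {A : Type*} [CommRing A] [Algebra A Λ] (P : Ideal A) [P.IsPrime]
    {M N Q : Type*} [AddCommGroup M] [Module Λ M] [AddCommGroup N] [Module Λ N] [AddCommGroup Q] [Module Λ Q]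
    [Module A M] [IsScalarTower A Λ M] [Module A N] [IsScalarTower A Λ N]
    [Module A Q] [IsScalarTower A Λ Q] (f : M →ₗ[Λ] N) (g : N →ₗ[Λ] Q)
    (hf : Function.Injective f) (hg : Function.Surjective g) (hfg : Function.Exact f g)
    (hM : Module.IsTorsion Λ M) :
    localLength P (torsion Λ N) =
      localLength P (torsion Λ M) + localLength P (torsion Λ Q) := by
  let f' : torsion Λ M →ₗ[Λ] torsion Λ N := f.restrict fun _ hx => map_mem_torsion f hx
  let g' : torsion Λ N →ₗ[Λ] torsion Λ Q := g.restrict fun _ hx => map_mem_torsion g hx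
  refine localLength_eq_add_of_exact P (f'.restrictScalars A) (g'.restrictScalars A) ?_ ?_ ?_
  · intro x y hxy
    exact Subtype.ext (hf (congrArg Subtype.val hxy))
  -- For a lift `n` of `q`, the element `b • n` comes from the torsion module `M`, so some `a` kills
  -- it and `a * b` kills `n`.
  · rintro ⟨q, b, hb⟩
    obtain ⟨n, rfl⟩ := hg q
    have hb : (b : Λ) • g n = 0 := hb
    rw [← map_smul] at hb
    obtain ⟨m, hm⟩ := (hfg _).mp hb
    obtain ⟨a, ha⟩ := @hM m
    have ha : (a : Λ) • m = 0 := ha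
    refine ⟨⟨n, a * b, ?_⟩, rfl⟩
    change ((a : Λ) * b) • n = 0
    rw [mul_smul, ← hm, ← map_smul, ha, map_zero]
  · rintro ⟨n, hn⟩
    constructor
    · intro h
      obtain ⟨m, hm⟩ := (hfg n).mp (congrArg Subtype.val h)
      exact ⟨⟨m, @hM m⟩, Subtype.ext hm⟩
    · rintro ⟨⟨m, hm'⟩, hm⟩
      have hm : f m = n := congrArg Subtype.val hm
      exact Subtype.ext ((hfg n).mpr ⟨m, hm⟩)

variable {Λ : Type*} [CommRing Λ] [IsDomain Λ] {r : ℕ}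
  {M E : Type*} [AddCommGroup M] [Module Λ M] [AddCommGroup E] [Module Λ E]

/-- A pseudo-isomorphism to the sum of a free module and a torsion module identifies the local
lengths of the torsion. -/
theorem localLength_torsion_eq [Infinite Λ] {A : Type*} [CommRing A] [Algebra A Λ] [Module A M]
    [IsScalarTower A Λ M] [Module A E] [IsScalarTower A Λ E] (P : Ideal A) [P.IsPrime]
    [Infinite (A ⧸ P)] (φ : M →ₗ[Λ] (Fin r → Λ) × E) (hφ : IsPseudoIso φ) {c : Λ} (hc : c ≠ 0)
    (hcE : ∀ e : E, c • e = 0) : localLength P (torsion Λ M) = localLength P E := by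
  obtain ⟨hker, hcoker⟩ := hφ
  have htors (m : M) (hm : m ∈ torsion Λ M) : (φ m).1 = 0 := by
    obtain ⟨a, ha⟩ := hm
    have ha : (a : Λ) • m = 0 := ha
    have h1 : (a : Λ) • (φ m).1 = 0 := by
      rw [← Prod.smul_fst, ← map_smul, ha, map_zero]
      rfl
    exact (smul_eq_zero.mp h1).resolve_left (nonZeroDivisors.coe_ne_zero a)
  have : Infinite (Λ ⧸ (⊥ : Ideal Λ)) :=
    (RingEquiv.quotientBot Λ).toEquiv.infinite_iff.mpr inferInstance
  refine localLength_eq_of_linearMap P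
    ((LinearMap.snd Λ (Fin r → Λ) E ∘ₗ φ ∘ₗ (torsion Λ M).subtype).restrictScalars A)
    (fun m hm => ?_) (fun e => ?_)
  · have hφm : φ m = 0 := Prod.ext (htors m m.2) hm
    obtain ⟨s, hs, hsm⟩ := exists_notMem_smul_eq_zero_of_finite P
      (⟨m, hφm⟩ : LinearMap.ker φ)
    have hsm' : s • (m : M) = 0 := congrArg Subtype.val hsm
    exact ⟨s, hs, Subtype.ext hsm'⟩
  · obtain ⟨s, hs, hse⟩ := exists_notMem_smul_eq_zero_of_finite P
      (Submodule.Quotient.mk (0, e) : ((Fin r → Λ) × E) ⧸ LinearMap.range φ)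
    rw [← Submodule.Quotient.mk_smul, Submodule.Quotient.mk_eq_zero] at hse
    obtain ⟨m, hm⟩ := hse
    -- The preimage `m` must be shown torsion: `c • m` lies in the finite kernel, so a nonzero `b`
    -- kills it.
    have hm1 : c • φ m = 0 := by
      rw [hm]
      refine Prod.ext ?_ (hcE _)
      change c • s • (0 : Fin r → Λ) = 0
      rw [smul_zero, smul_zero]
    rw [← map_smul] at hm1
    obtain ⟨b, hb, hbm⟩ := exists_notMem_smul_eq_zero_of_finite (⊥ : Ideal Λ)
      (⟨c • m, hm1⟩ : LinearMap.ker φ)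
    have hbm' : b • c • m = 0 := congrArg Subtype.val hbm
    refine ⟨s, hs, ⟨m, ⟨b * c, mem_nonZeroDivisors_of_ne_zero (mul_ne_zero hb hc)⟩, ?_⟩, ?_⟩
    · change (b * c) • m = 0
      rw [mul_smul, hbm']
    · change (φ m).2 = s • e
      rw [hm]
      rfl

end Torsion

/-! ### Local lengths of elementary modules. -/

section Values

variable {O Λ : Type*} [CommRing O] [IsDomain O] [IsDiscreteValuationRing O]
  [CommRing Λ] [Algebra O Λ] {ϖ : O} {T : Λ}

theorem localLength_bot_self (O : Type*) [CommRing O] [IsDomain O] :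
    localLength (⊥ : Ideal O) O = 1 := by
  rw [← localLength_quotient_self (⊥ : Ideal O)]
  exact localLength_congr _ (Submodule.quotEquivOfEqBot (⊥ : Ideal O) rfl).symm

namespace IsWeierstrassAlgebra

variable (h : IsWeierstrassAlgebra ϖ T)
include h

/-- Over the fraction field of `O` the `ϖ`-part vanishes, and `Λ/(F_j)` has dimension `deg F_j`
because it is free over `O`. -/
theorem localLength_bot_elementary (hϖ : Irreducible ϖ) {s t : ℕ} (a : Fin s → ℕ)
    (F : Fin t → O[X]) (hF : ∀ j, (F j).IsDistinguishedAt (maximalIdeal O)) :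
    localLength (⊥ : Ideal O) ((∀ i, Λ ⧸ Ideal.span {algebraMap O Λ ϖ ^ a i}) ×
        (∀ j, Λ ⧸ Ideal.span {aeval T (F j)})) = ((∑ j, (F j).natDegree : ℕ) : ℕ∞) := by
  rw [localLength_prod, localLength_eq_zero _ (M := ∀ i, Λ ⧸ Ideal.span {algebraMap O Λ ϖ ^ a i}),
    localLength_pi, zero_add, Nat.cast_sum]
  · refine Finset.sum_congr rfl fun j _ => ?_
    obtain ⟨e⟩ := h.quotientEquiv (F j) (hF j)
    rw [← localLength_congr _ e, localLength_pi, Finset.sum_congr rfl fun _ _ => localLength_bot_self O]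
    simp
  · intro e
    refine ⟨ϖ ^ ∑ i, a i, pow_ne_zero _ hϖ.ne_zero, ?_⟩
    rw [← algebraMap_smul Λ, map_pow, pow_sum_smul_eq_zero]

/-- Multiplication by `π^a` embeds `Λ/(π)` in `Λ/(π^(a+1))` with quotient `Λ/(π^a)`, so each step
adds one. -/
theorem localLength_span_pow [(Ideal.span {algebraMap O Λ ϖ}).IsPrime] [IsDomain Λ] (a : ℕ) :
    localLength (Ideal.span {algebraMap O Λ ϖ}) (Λ ⧸ Ideal.span {algebraMap O Λ ϖ ^ a}) = a := by
  set π := algebraMap O Λ ϖ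
  have hπ : Prime π := h.prime
  induction a with
  | zero =>
    refine localLength_eq_zero _ fun x => ⟨1, ?_, ?_⟩
    · rw [Ideal.mem_span_singleton]
      exact hπ.not_dvd_one
    · have : Subsingleton (Λ ⧸ Ideal.span {π ^ 0}) := by
        rw [pow_zero]
        exact Ideal.Quotient.subsingleton_iff.mpr Ideal.span_singleton_one
      exact Subsingleton.elim _ _
  | succ a ih =>
    have hle : Ideal.span {π ^ (a + 1)} ≤ Ideal.span {π ^ a} := by
      rw [Ideal.span_singleton_le_span_singleton]
      exact pow_dvd_pow _ a.le_succ
    have hmem (x : Λ) : π ^ a * x ∈ Ideal.span {π ^ (a + 1)} ↔ x ∈ Ideal.span {π} := by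
      rw [Ideal.mem_span_singleton, Ideal.mem_span_singleton, pow_succ,
        mul_dvd_mul_iff_left (pow_ne_zero a hπ.ne_zero)]
    have hmap : Ideal.span {π} ≤
        Submodule.comap (LinearMap.lsmul Λ Λ (π ^ a)) (Ideal.span {π ^ (a + 1)}) :=
      fun x hx => (hmem x).mpr hx
    rw [localLength_eq_add_of_exact (Ideal.span {π})
      (Submodule.mapQ (Ideal.span {π}) (Ideal.span {π ^ (a + 1)}) (LinearMap.lsmul Λ Λ (π ^ a)) hmap)
      (Submodule.factor hle) ?_ (Submodule.factor_surjective hle) ?_, ih,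
      localLength_quotient_self, add_comm, Nat.cast_succ]
    · rw [injective_iff_map_eq_zero]
      intro x hx
      obtain ⟨x, rfl⟩ := Submodule.Quotient.mk_surjective _ x
      rw [Submodule.mapQ_apply, Submodule.Quotient.mk_eq_zero] at hx
      exact (Submodule.Quotient.mk_eq_zero _).mpr ((hmem x).mp hx)
    · intro y
      obtain ⟨y, rfl⟩ := Submodule.Quotient.mk_surjective _ y
      have h1 : Submodule.factor hle (Submodule.Quotient.mk y) = 0 ↔ π ^ a ∣ y := by
        rw [← Ideal.mem_span_singleton]
        exact Submodule.Quotient.mk_eq_zero _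
      rw [h1]
      constructor
      · rintro ⟨x, rfl⟩
        exact ⟨Submodule.Quotient.mk x, rfl⟩
      · rintro ⟨x, hx⟩
        obtain ⟨x, rfl⟩ := Submodule.Quotient.mk_surjective _ x
        rw [Submodule.mapQ_apply, Submodule.Quotient.eq] at hx
        have h2 := Ideal.mem_span_singleton.mp (hle hx)
        exact (dvd_sub_right (dvd_mul_right _ _)).mp h2

theorem localLength_span_elementary (hϖ : Irreducible ϖ) [IsDomain Λ]
    [(Ideal.span {algebraMap O Λ ϖ}).IsPrime] {s t : ℕ} (a : Fin s → ℕ)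
    (F : Fin t → O[X]) (hF : ∀ j, (F j).IsDistinguishedAt (maximalIdeal O)) :
    localLength (Ideal.span {algebraMap O Λ ϖ})
      ((∀ i, Λ ⧸ Ideal.span {algebraMap O Λ ϖ ^ a i}) ×
        (∀ j, Λ ⧸ Ideal.span {aeval T (F j)})) = ((∑ i, a i : ℕ) : ℕ∞) := by
  rw [localLength_prod, localLength_pi, localLength_eq_zero _ (M := ∀ j, Λ ⧸ Ideal.span {aeval T (F j)}),
    add_zero, Nat.cast_sum]
  · exact Finset.sum_congr rfl fun i _ => h.localLength_span_pow (a i)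
  · intro e
    refine ⟨∏ j, aeval T (F j), ?_, prod_aeval_smul_eq_zero F e⟩
    rw [Ideal.mem_span_singleton]
    intro hd
    obtain ⟨j, -, hj⟩ := (h.prime.dvd_finsetProd_iff _).mp hd
    exact h.not_dvd_aeval hϖ (hF j) hj

end IsWeierstrassAlgebra

end Values

end Iwasawa

namespace Iwasawa

open IsLocalRing Polynomial Submodule

section FiniteQuotient

/-- The quotients of `O` by the powers of a uniformizer are finite. -/
theorem finite_quotient_span_pow (p : ℕ) [Fact p.Prime] (O : Type*) [CommRing O] [IsDomain O]
    [IsDiscreteValuationRing O] [CharZero O] [Algebra ℤ_[p] O] [Module.Finite ℤ_[p] O]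
    {ϖ : O} (hϖ : Irreducible ϖ) (n : ℕ) : Finite (O ⧸ Ideal.span {ϖ ^ n}) := by
  have hpϖ : ϖ ∣ (p : O) := by
    rw [← Ideal.mem_span_singleton, ← hϖ.maximalIdeal_eq]
    exact natCast_mem_maximalIdeal p O
  have hpos : NeZero (p ^ n) := ⟨pow_ne_zero n (Fact.out : p.Prime).ne_zero⟩
  obtain ⟨k, x, hx⟩ := Module.Finite.exists_fin (R := ℤ_[p]) (M := O)
  let ψ : (Fin k → ZMod (p ^ n)) → O ⧸ Ideal.span {ϖ ^ n} := fun a =>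
    Ideal.Quotient.mk _ (∑ i, ((a i).val : ℤ_[p]) • x i)
  refine Finite.of_surjective ψ fun y => ?_
  obtain ⟨y, rfl⟩ := Ideal.Quotient.mk_surjective y
  have hy : y ∈ Submodule.span ℤ_[p] (Set.range x) := by rw [hx]; trivial
  obtain ⟨c, rfl⟩ := (Submodule.mem_span_range_iff_exists_fun ℤ_[p]).mp hy
  refine ⟨fun i => PadicInt.toZModPow n (c i), ?_⟩
  rw [Ideal.Quotient.eq, ← Finset.sum_sub_distrib]
  refine sum_mem fun i _ => ?_
  rw [← sub_smul, Algebra.smul_def]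
  refine Ideal.mul_mem_right _ _ ?_
  have h1 : (((PadicInt.toZModPow n (c i)).val : ℤ_[p]) - c i) ∈ Ideal.span {(p : ℤ_[p]) ^ n} := by
    rw [← PadicInt.ker_toZModPow, RingHom.mem_ker, map_sub, map_natCast, ZMod.natCast_zmod_val,
      sub_self]
  obtain ⟨d, hd⟩ := Ideal.mem_span_singleton.mp h1
  rw [hd, map_mul, map_pow, map_natCast]
  exact Ideal.mul_mem_right _ _ (Ideal.mem_span_singleton.mpr (pow_dvd_pow_of_dvd hpϖ n))

end FiniteQuotient

/-! ### The invariants as local lengths. -/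

section Invariants

variable {p : ℕ} {Γ : Type*} [CommGroup Γ] {O : Type*} [CommRing O] [IsDomain O]
  [IsDiscreteValuationRing O] {γ : Γ} {ϖ : O}
  {M : Type*} [AddCommGroup M] [Module (IwasawaAlgebra p Γ O) M]

theorem Decomposition.exists_isPseudoIso (d : Decomposition p γ ϖ M) :
    ∃ φ : M →ₗ[IwasawaAlgebra p Γ O] (Fin d.r → IwasawaAlgebra p Γ O) ×
      (∀ i, IwasawaAlgebra p Γ O ⧸ Ideal.span {algebraMap O (IwasawaAlgebra p Γ O) ϖ ^ d.a i}) ×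
      (∀ j, IwasawaAlgebra p Γ O ⧸ Ideal.span {aeval (groupLike p O γ - 1) (d.F j)}),
      IsPseudoIso φ :=
  ⟨d.toElementary, d.isPseudoIso⟩

theorem invariantsWellDefined_of_forall {l m : ℕ∞} (hne : Nonempty (Decomposition p γ ϖ M))
    (hl : ∀ d : Decomposition p γ ϖ M, (d.lambda : ℕ∞) = l)
    (hm : ∀ d : Decomposition p γ ϖ M, (d.mu : ℕ∞) = m) :
    InvariantsWellDefined p γ ϖ M ∧ (lambdaInvariant p γ ϖ M : ℕ∞) = l ∧
      (muInvariant p γ ϖ M : ℕ∞) = m := by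
  have h1 : (lambdaInvariant p γ ϖ M : ℕ∞) = l := by
    rw [lambdaInvariant, dif_pos hne, hl]
  have h2 : (muInvariant p γ ϖ M : ℕ∞) = m := by
    rw [muInvariant, dif_pos hne, hm]
  refine ⟨⟨hne, fun d => ⟨?_, ?_⟩⟩, h1, h2⟩
  · exact Nat.cast_injective (R := ℕ∞) ((hm d).trans h2.symm)
  · exact Nat.cast_injective (R := ℕ∞) ((hl d).trans h1.symm)

variable (h : IsWeierstrassAlgebra ϖ (groupLike p O γ - 1)) (hϖ : Irreducible ϖ)
  [IsDomain (IwasawaAlgebra p Γ O)]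

include h hϖ

theorem nonempty_decomposition [IsNoetherianRing (IwasawaAlgebra p Γ O)]
    [IsLocalRing (IwasawaAlgebra p Γ O)] [∀ n, Finite (O ⧸ Ideal.span {ϖ ^ n})]
    [Module.Finite (IwasawaAlgebra p Γ O) M] : Nonempty (Decomposition p γ ϖ M) := by
  obtain ⟨r, s, t, a, F, ha, hF, φ, hφ⟩ := h.exists_isPseudoIso (M := M) hϖ
  exact ⟨⟨r, s, t, a, ha, F, hF, φ, hφ⟩⟩

theorem elementary_smul_eq_zero {s t : ℕ} (a : Fin s → ℕ) (F : Fin t → O[X])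
    (hF : ∀ j, (F j).IsDistinguishedAt (maximalIdeal O)) :
    ∃ c : IwasawaAlgebra p Γ O, c ≠ 0 ∧
      ∀ e : (∀ i, IwasawaAlgebra p Γ O ⧸ Ideal.span {algebraMap O (IwasawaAlgebra p Γ O) ϖ ^ a i}) ×
        (∀ j, IwasawaAlgebra p Γ O ⧸ Ideal.span {aeval (groupLike p O γ - 1) (F j)}),
      c • e = 0 := by
  refine ⟨algebraMap O (IwasawaAlgebra p Γ O) ϖ ^ (∑ i, a i) *
    ∏ j, aeval (groupLike p O γ - 1) (F j), mul_ne_zero (pow_ne_zero _ h.prime.ne_zero)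
      (Finset.prod_ne_zero_iff.mpr fun j _ h0 => h.not_dvd_aeval hϖ (hF j) (h0 ▸ dvd_zero _)),
    fun e => Prod.ext ?_ ?_⟩
  · rw [Prod.smul_fst, mul_comm, mul_smul, pow_sum_smul_eq_zero, smul_zero]
    rfl
  · rw [Prod.smul_snd, mul_smul, prod_aeval_smul_eq_zero, smul_zero]
    rfl

/-- The right-hand side does not involve `d`, which gives independence of the decomposition.
Characteristic zero makes `O` infinite, so finite modules vanish at the zero ideal. -/
theorem Decomposition.lambda_eq [CharZero O] [Infinite (IwasawaAlgebra p Γ O)] [Module O M]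
    [IsScalarTower O (IwasawaAlgebra p Γ O) M] (d : Decomposition p γ ϖ M) :
    (d.lambda : ℕ∞) = localLength (⊥ : Ideal O) (torsion (IwasawaAlgebra p Γ O) M) := by
  obtain ⟨c, hc, hcE⟩ := elementary_smul_eq_zero h hϖ d.a d.F d.distinguished
  have : Infinite (O ⧸ (⊥ : Ideal O)) :=
    (RingEquiv.quotientBot O).toEquiv.infinite_iff.mpr inferInstance
  rw [Decomposition.lambda, ← h.localLength_bot_elementary hϖ d.a d.F d.distinguished]
  obtain ⟨φ, hφ⟩ := d.exists_isPseudoIso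
  exact (localLength_torsion_eq _ φ hφ hc hcE).symm

theorem Decomposition.mu_eq [IsLocalRing (IwasawaAlgebra p Γ O)] [Infinite (IwasawaAlgebra p Γ O)]
    [(Ideal.span {algebraMap O (IwasawaAlgebra p Γ O) ϖ}).IsPrime] (d : Decomposition p γ ϖ M) :
    (d.mu : ℕ∞) = localLength (Ideal.span {algebraMap O (IwasawaAlgebra p Γ O) ϖ})
      (torsion (IwasawaAlgebra p Γ O) M) := by
  obtain ⟨c, hc, hcE⟩ := elementary_smul_eq_zero h hϖ d.a d.F d.distinguished
  have := h.infinite_quotient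
  rw [Decomposition.mu, ← h.localLength_span_elementary hϖ d.a d.F d.distinguished]
  obtain ⟨φ, hφ⟩ := d.exists_isPseudoIso
  exact (localLength_torsion_eq _ φ hφ hc hcE).symm

end Invariants

end Iwasawa

theorem mainTheorem9
    -- `O` is the ring of integers of a finite extension of `ℚ_p`, with uniformizer `ϖ`
    (p : ℕ) [Fact p.Prime]
    (O : Type*) [CommRing O] [IsDomain O] [IsDiscreteValuationRing O] [CharZero O]
    [Algebra ℤ_[p] O] [Module.Finite ℤ_[p] O]
    (ϖ : O) (hϖ : Irreducible ϖ)
    -- `Γ ≅ ℤ_p` as a topological group, with topological generator `γ`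
    (Γ : Type*) [CommGroup Γ] [TopologicalSpace Γ] [IsTopologicalGroup Γ]
    (hΓ : Nonempty (Γ ≃ₜ* Multiplicative ℤ_[p]))
    (γ : Γ) (hγ : (Subgroup.zpowers γ).topologicalClosure = ⊤)
    (A B C : Type*) [AddCommGroup A] [AddCommGroup B] [AddCommGroup C]
    [Module (Iwasawa.IwasawaAlgebra p Γ O) A] [Module (Iwasawa.IwasawaAlgebra p Γ O) B]
    [Module (Iwasawa.IwasawaAlgebra p Γ O) C]
    [Module.Finite (Iwasawa.IwasawaAlgebra p Γ O) A]
    [Module.Finite (Iwasawa.IwasawaAlgebra p Γ O) B]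
    [Module.Finite (Iwasawa.IwasawaAlgebra p Γ O) C]
    (f : A →ₗ[Iwasawa.IwasawaAlgebra p Γ O] B) (g : B →ₗ[Iwasawa.IwasawaAlgebra p Γ O] C)
    (hf : Function.Injective f) (hfg : Function.Exact f g) (hg : Function.Surjective g)
    (hA : Module.IsTorsion (Iwasawa.IwasawaAlgebra p Γ O) A) :
    (Iwasawa.InvariantsWellDefined p γ ϖ A ∧ Iwasawa.InvariantsWellDefined p γ ϖ B ∧
        Iwasawa.InvariantsWellDefined p γ ϖ C) ∧
      Iwasawa.lambdaInvariant p γ ϖ A + Iwasawa.lambdaInvariant p γ ϖ C =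
        Iwasawa.lambdaInvariant p γ ϖ B ∧
      Iwasawa.muInvariant p γ ϖ A + Iwasawa.muInvariant p γ ϖ C =
        Iwasawa.muInvariant p γ ϖ B := by
  obtain ⟨φ⟩ := hΓ
  obtain ⟨e, he⟩ := Iwasawa.exists_powerSeries_algEquiv p O φ hγ
  have := Iwasawa.isAdicComplete_maximalIdeal p O
  have h : Iwasawa.IsWeierstrassAlgebra ϖ (Iwasawa.groupLike p O γ - 1) :=
    he ▸ (Iwasawa.powerSeries_isWeierstrassAlgebra hϖ).of_algEquiv e
  have : IsDomain (Iwasawa.IwasawaAlgebra p Γ O) := e.symm.toMulEquiv.isDomain _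
  have : IsNoetherianRing (Iwasawa.IwasawaAlgebra p Γ O) :=
    isNoetherianRing_of_ringEquiv _ e.toRingEquiv
  have : IsLocalRing (Iwasawa.IwasawaAlgebra p Γ O) := e.toRingEquiv.isLocalRing
  have hP := h.isPrime_span
  have := h.infinite_quotient
  have : Infinite (Iwasawa.IwasawaAlgebra p Γ O) :=
    Infinite.of_surjective _ (Ideal.Quotient.mk_surjective
      (I := Ideal.span {algebraMap O (Iwasawa.IwasawaAlgebra p Γ O) ϖ}))
  have := Iwasawa.finite_quotient_span_pow p O hϖ
  -- The `λ`-invariant is a length over a localization of `O`, so the modules are viewed over `O` by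
  -- restriction of scalars.
  let := Module.compHom A (algebraMap O (Iwasawa.IwasawaAlgebra p Γ O))
  let := Module.compHom B (algebraMap O (Iwasawa.IwasawaAlgebra p Γ O))
  let := Module.compHom C (algebraMap O (Iwasawa.IwasawaAlgebra p Γ O))
  have : IsScalarTower O (Iwasawa.IwasawaAlgebra p Γ O) A :=
    IsScalarTower.of_algebraMap_smul fun _ _ => rfl
  have : IsScalarTower O (Iwasawa.IwasawaAlgebra p Γ O) B :=
    IsScalarTower.of_algebraMap_smul fun _ _ => rfl
  have : IsScalarTower O (Iwasawa.IwasawaAlgebra p Γ O) C :=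
    IsScalarTower.of_algebraMap_smul fun _ _ => rfl
  obtain ⟨hwA, hlA, hmA⟩ := Iwasawa.invariantsWellDefined_of_forall (M := A)
    (Iwasawa.nonempty_decomposition h hϖ) (Iwasawa.Decomposition.lambda_eq h hϖ)
    (Iwasawa.Decomposition.mu_eq h hϖ)
  obtain ⟨hwB, hlB, hmB⟩ := Iwasawa.invariantsWellDefined_of_forall (M := B)
    (Iwasawa.nonempty_decomposition h hϖ) (Iwasawa.Decomposition.lambda_eq h hϖ)
    (Iwasawa.Decomposition.mu_eq h hϖ)
  obtain ⟨hwC, hlC, hmC⟩ := Iwasawa.invariantsWellDefined_of_forall (M := C)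
    (Iwasawa.nonempty_decomposition h hϖ) (Iwasawa.Decomposition.lambda_eq h hϖ)
    (Iwasawa.Decomposition.mu_eq h hϖ)
  refine ⟨⟨hwA, hwB, hwC⟩, ?_, ?_⟩
  · apply Nat.cast_injective (R := ℕ∞)
    rw [Nat.cast_add, hlA, hlB, hlC]
    exact (Iwasawa.localLength_torsion_add _ f g hf hg hfg hA).symm
  · apply Nat.cast_injective (R := ℕ∞)
    rw [Nat.cast_add, hmA, hmB, hmC]
    exact (Iwasawa.localLength_torsion_add _ f g hf hg hfg hA).symm
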